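/- Let $d\in\{2,3\}$ and let $D\subset\mathbb R^d$ be a bounded open set. Let $\mathrm{Re}\ge 0$, $\mathrm{Wi}>0$, $\varepsilon\in(0,1)$ and $T\in(0,+\infty]$. Write $(\nabla u)_{ij}=\partial u_i/\partial x_j$, and let $C^1(D)$ be the Banach space of continuously differentiable functions on $D$ that are bounded together with their gradient. Let $(u,p,\psi)$, with $\psi(t,x)\in\mathbb R^{d\times d}$ symmetric, be a smooth solution on $[0,T)\times D$ of the log-conformation Oldroyd-B system $$\mathrm{Re}\left(\frac{\partial u}{\partial t}+u\cdot\nabla u\right)=-\nabla p+(1-\varepsilon)\Delta u+\frac{\varepsilon}{\mathrm{Wi}}\operatorname{div}e^{\psi},\qquad \operatorname{div}u=0,$$ $$\frac{\partial\psi}{\partial t}+(u\cdot\nabla)\psi=\Omega\psi-\psi\Omega+2B+\frac1{\mathrm{Wi}}\left(e^{-\psi}-I\right),$$ with $u=0$ on $\partial D$, where at each point $\Omega$ and $B$ come from a decomposition $\nabla u=\Omega+B+Ne^{-\psi}$ with $\Omega,N$ antisymmetric and $B$ symmetric and commuting with $e^\psi$. Here "smooth" means $$u\in C^1([0,T),H^2(D))^d,\qquad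 p\in C^0([0,T),H^1(D)),\qquad \psi\in C^1([0,T),C^1(D))^{d\times d},$$ the boundary condition means $u(t)\in H^1_0(D)^d$ for all $t\in[0,T)$, and the equations hold for every $t\in[0,T)$ and almost every $x\in D$. Define the free energy $$F(u,e^\psi)=\frac{\mathrm{Re}}2\int_D|u|^2+\frac{\varepsilon}{2\mathrm{Wi}}\int_D\operatorname{tr}(e^\psi-\psi-I).$$ Then all integrals below converge absolutely, $t\mapsto F(u,e^\psi)$ is differentiable on $[0,T)$ (from the right at $t=0$), and for all $t\in[0,T)$ $$\frac{d}{dt}F(u,e^\psi)+(1-\varepsilon)\int_D|\nabla u|^2+\frac{\varepsilon}{2\mathrm{Wi}^2}\int_D\operatorname{tr}(e^\psi+e^{-\psi}-2I)=0 .$$ Consequently $F\ge 0$ decreases exponentially fast in time to zero: there is a constant $C>0$ depending only on $D$ such that, with $$\lambda=\min\left(\frac{2(1-\varepsilon)}{\mathrm{Re}\,C},\frac1{\mathrm{Wi}}\right)>0\qquad(\lambda=1/\mathrm{Wi}\text{ if }\mathrm{Re}=0),$$ one has $F(t)\le F(s)\,e^{-\lambda(t-s)}$ for all $0\le s\le t<T$,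 where $F(t)$ is the value of $F(u,e^\psi)$ at time $t$; in particular $F(t)\to0$ as $t\to\infty$ if $T=+\infty$. -/

import Mathlib

open MeasureTheory TopologicalSpace
open scoped BoundedContinuousFunction ENNReal

noncomputable section

namespace LogOldroydB

variable {d : ℕ}

/-! ### Sobolev spaces on an open set `D ⊆ ℝ^d`

All integrals over `D` are taken with respect to Lebesgue measure on the subtype `D`. -/

/-- Lebesgue measure on the subtype `D`. -/
instance instMeasureSpaceOpens (D : Opens (EuclideanSpace ℝ (Fin d))) : MeasureSpace D :=
  Measure.Subtype.measureSpace (p := fun x => x ∈ D)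

/-- The `i`-th vector of the standard basis of `ℝ^d`. -/
def basisVec (i : Fin d) : EuclideanSpace ℝ (Fin d) := EuclideanSpace.single i 1

/-- `L²(D)`. -/
abbrev L2 (D : Opens (EuclideanSpace ℝ (Fin d))) : Type :=
  Lp ℝ 2 (volume : Measure D)

/-- The classical partial derivative `∂φ/∂x_i` of a test function `φ ∈ C_c^∞(D)`. -/
def partialTest {D : Opens (EuclideanSpace ℝ (Fin d))} (φ : TestFunction D ℝ ⊤) (i : Fin d)
    (x : EuclideanSpace ℝ (Fin d)) : ℝ :=
  fderiv ℝ φ x (basisVec i)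

/-- `g` is the weak partial derivative of `f` in `D` with respect to `x_i`. -/
def HasWeakPartial {D : Opens (EuclideanSpace ℝ (Fin d))} (f g : L2 D) (i : Fin d) : Prop :=
  ∀ φ : TestFunction D ℝ ⊤,
    ∫ x : D, f x * partialTest φ i x = - ∫ x : D, g x * φ x

theorem memLp_subtype {D : Opens (EuclideanSpace ℝ (Fin d))}
    {f : EuclideanSpace ℝ (Fin d) → ℝ} (hf : Continuous f) (hc : HasCompactSupport f) :
    MemLp (fun x : D => f x) 2 (volume : Measure D) :=
  (((hf.memLp_of_hasCompactSupport (p := 2) (μ := volume) hc).restrict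
    (D : Set (EuclideanSpace ℝ (Fin d))))).comp_measurePreserving
      (measurePreserving_subtype_coe D.isOpen.measurableSet)

theorem integrable_mul_test {D : Opens (EuclideanSpace ℝ (Fin d))} (f : L2 D)
    (φ : TestFunction D ℝ ⊤) : Integrable (fun x : D => f x * φ x) volume :=
  MemLp.integrable_mul (Lp.memLp f) (memLp_subtype φ.continuous φ.hasCompactSupport)

theorem integrable_mul_partialTest {D : Opens (EuclideanSpace ℝ (Fin d))} (f : L2 D)
    (φ : TestFunction D ℝ ⊤) (i : Fin d) :
    Integrable (fun x : D => f x * partialTest φ i x) volume := by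
  refine MemLp.integrable_mul (Lp.memLp f) (memLp_subtype (f := partialTest φ i) ?_ ?_)
  · have h := φ.contDiff.continuous_fderiv (by simp)
    exact h.clm_apply continuous_const
  · exact (φ.hasCompactSupport.fderiv (𝕜 := ℝ)).comp_left
      (g := fun L : EuclideanSpace ℝ (Fin d) →L[ℝ] ℝ => L (basisVec i)) (by simp)

theorem HasWeakPartial.zero {D : Opens (EuclideanSpace ℝ (Fin d))} (i : Fin d) :
    HasWeakPartial (0 : L2 D) 0 i := by
  intro φ
  have h : ((0 : L2 D) : D → ℝ) =ᵐ[volume] 0 := Lp.coeFn_zero ℝ 2 volume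
  rw [integral_eq_zero_of_ae, integral_eq_zero_of_ae, neg_zero]
  · filter_upwards [h] with x hx
    rw [hx, Pi.zero_apply, zero_mul]
  · filter_upwards [h] with x hx
    rw [hx, Pi.zero_apply, zero_mul]

theorem HasWeakPartial.add {D : Opens (EuclideanSpace ℝ (Fin d))} {f f' g g' : L2 D} {i : Fin d}
    (h : HasWeakPartial f g i) (h' : HasWeakPartial f' g' i) :
    HasWeakPartial (f + f') (g + g') i := by
  intro φ
  have e1 : ∫ x : D, (f + f' : L2 D) x * partialTest φ i x =
      ∫ x : D, (f x * partialTest φ i x + f' x * partialTest φ i x) := by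
    refine integral_congr_ae ?_
    filter_upwards [Lp.coeFn_add f f'] with x hx
    rw [hx, Pi.add_apply, add_mul]
  have e2 : ∫ x : D, (g + g' : L2 D) x * φ x = ∫ x : D, (g x * φ x + g' x * φ x) := by
    refine integral_congr_ae ?_
    filter_upwards [Lp.coeFn_add g g'] with x hx
    rw [hx, Pi.add_apply, add_mul]
  rw [e1, e2, integral_add (integrable_mul_partialTest f φ i) (integrable_mul_partialTest f' φ i),
    integral_add (integrable_mul_test g φ) (integrable_mul_test g' φ), h φ, h' φ, neg_add]

theorem HasWeakPartial.smul {D : Opens (EuclideanSpace ℝ (Fin d))} {f g : L2 D} {i : Fin d}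
    (c : ℝ) (h : HasWeakPartial f g i) : HasWeakPartial (c • f) (c • g) i := by
  intro φ
  have e1 : ∫ x : D, (c • f : L2 D) x * partialTest φ i x =
      ∫ x : D, c * (f x * partialTest φ i x) := by
    refine integral_congr_ae ?_
    filter_upwards [Lp.coeFn_smul c f] with x hx
    rw [hx, Pi.smul_apply, smul_eq_mul, mul_assoc]
  have e2 : ∫ x : D, (c • g : L2 D) x * φ x = ∫ x : D, c * (g x * φ x) := by
    refine integral_congr_ae ?_
    filter_upwards [Lp.coeFn_smul c g] with x hx
    rw [hx, Pi.smul_apply, smul_eq_mul, mul_assoc]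
  rw [e1, e2, integral_const_mul, integral_const_mul, h φ, mul_neg]

/-- `H¹(D)`, realized as the space of pairs `(f, ∇f)` with `f ∈ L²(D)` and weak gradient
`∇f ∈ L²(D)^d`; the norm is equivalent to the usual `H¹` norm. -/
def H1Sub (D : Opens (EuclideanSpace ℝ (Fin d))) : Submodule ℝ (L2 D × (Fin d → L2 D)) where
  carrier := {w | ∀ i, HasWeakPartial w.1 (w.2 i) i}
  zero_mem' := fun i => HasWeakPartial.zero i
  add_mem' := fun h h' i => (h i).add (h' i)
  smul_mem' := fun c _ h i => (h i).smul c

/-- `H¹(D)` as a normed space. -/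
abbrev H1 (D : Opens (EuclideanSpace ℝ (Fin d))) : Type := H1Sub D

instance (D : Opens (EuclideanSpace ℝ (Fin d))) : NormedAddCommGroup (H1 D) :=
  inferInstanceAs (NormedAddCommGroup (H1Sub D))

instance (D : Opens (EuclideanSpace ℝ (Fin d))) : NormedSpace ℝ (H1 D) :=
  inferInstanceAs (NormedSpace ℝ (H1Sub D))

/-- The underlying `L²` function of `f ∈ H¹(D)`. -/
def H1.fn {D : Opens (EuclideanSpace ℝ (Fin d))} (w : H1 D) : L2 D := w.1.1

/-- The weak partial derivative `∂f/∂x_i` of `f ∈ H¹(D)`. -/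
def H1.grad {D : Opens (EuclideanSpace ℝ (Fin d))} (w : H1 D) (i : Fin d) : L2 D := w.1.2 i

/-- `H¹₀(D)`: the closure of `C_c^∞(D)` in `H¹(D)`. -/
def H10 (D : Opens (EuclideanSpace ℝ (Fin d))) : Set (H1 D) :=
  closure {w | ∃ φ : TestFunction D ℝ ⊤, (∀ᵐ x : D, w.fn x = φ x) ∧
    ∀ i, ∀ᵐ x : D, w.grad i x = partialTest φ i x}

/-- `H²(D)`: the functions `f ∈ H¹(D)` all of whose weak partial derivatives are in `H¹(D)`,
realized as tuples `(f, ∂_1 f, …, ∂_d f)` of elements of `H¹(D)`; the norm is equivalent to the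
usual `H²` norm. -/
def H2Sub (D : Opens (EuclideanSpace ℝ (Fin d))) : Submodule ℝ (H1 D × (Fin d → H1 D)) where
  carrier := {w | ∀ i, (w.2 i).fn = w.1.grad i}
  zero_mem' := fun _ => rfl
  add_mem' := fun {a b} h h' i => by
    change (a.2 i).fn + (b.2 i).fn = a.1.grad i + b.1.grad i
    rw [h i, h' i]
  smul_mem' := fun c a h i => by
    change c • (a.2 i).fn = c • a.1.grad i
    rw [h i]

/-- `H²(D)` as a normed space. -/
abbrev H2 (D : Opens (EuclideanSpace ℝ (Fin d))) : Type := H2Sub D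

instance (D : Opens (EuclideanSpace ℝ (Fin d))) : NormedAddCommGroup (H2 D) :=
  inferInstanceAs (NormedAddCommGroup (H2Sub D))

instance (D : Opens (EuclideanSpace ℝ (Fin d))) : NormedSpace ℝ (H2 D) :=
  inferInstanceAs (NormedSpace ℝ (H2Sub D))

/-- The inclusion of `H²(D)` in `H¹(D)`. -/
def H2.toH1 {D : Opens (EuclideanSpace ℝ (Fin d))} (w : H2 D) : H1 D := w.1.1

/-- The underlying `L²` function of `f ∈ H²(D)`. -/
def H2.fn {D : Opens (EuclideanSpace ℝ (Fin d))} (w : H2 D) : L2 D := w.toH1.fn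

/-- The weak partial derivative `∂f/∂x_i` of `f ∈ H²(D)`. -/
def H2.grad {D : Opens (EuclideanSpace ℝ (Fin d))} (w : H2 D) (i : Fin d) : L2 D := w.toH1.grad i

/-- The weak second partial derivative `∂²f/∂x_j∂x_i` of `f ∈ H²(D)`. -/
def H2.hess {D : Opens (EuclideanSpace ℝ (Fin d))} (w : H2 D) (i j : Fin d) : L2 D :=
  (w.1.2 i).grad j

/-! ### The space `C¹(D)` -/

/-- The extension by zero of a function on `D`; only its germs at points of `D` are used. -/
def extendZero {D : Opens (EuclideanSpace ℝ (Fin d))} (f : D → ℝ) :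
    EuclideanSpace ℝ (Fin d) → ℝ :=
  Function.extend (Subtype.val : D → EuclideanSpace ℝ (Fin d)) f 0

theorem extendZero_zero {D : Opens (EuclideanSpace ℝ (Fin d))} :
    extendZero (0 : D → ℝ) = 0 := by
  funext x
  by_cases h : ∃ a : D, (a : EuclideanSpace ℝ (Fin d)) = x
  · obtain ⟨a, rfl⟩ := h
    simp [extendZero]
  · simp [extendZero, Function.extend_apply' _ _ _ h]

theorem extendZero_add {D : Opens (EuclideanSpace ℝ (Fin d))} (f g : D → ℝ) :
    extendZero (f + g) = extendZero f + extendZero g := by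
  funext x
  by_cases h : ∃ a : D, (a : EuclideanSpace ℝ (Fin d)) = x
  · obtain ⟨a, rfl⟩ := h
    simp [extendZero]
  · simp [extendZero, Function.extend_apply' _ _ _ h]

theorem extendZero_smul {D : Opens (EuclideanSpace ℝ (Fin d))} (c : ℝ) (f : D → ℝ) :
    extendZero (c • f) = c • extendZero f := by
  funext x
  by_cases h : ∃ a : D, (a : EuclideanSpace ℝ (Fin d)) = x
  · obtain ⟨a, rfl⟩ := h
    simp [extendZero]
  · simp [extendZero, Function.extend_apply' _ _ _ h]

/-- The linear map `h ↦ ∑_k g_k h_k`. -/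
def gradForm (g : Fin d → ℝ) : EuclideanSpace ℝ (Fin d) →L[ℝ] ℝ :=
  ∑ k, g k • (EuclideanSpace.proj k : EuclideanSpace ℝ (Fin d) →L[ℝ] ℝ)

theorem gradForm_zero : gradForm (0 : Fin d → ℝ) = 0 := by
  simp [gradForm]

theorem gradForm_add (g h : Fin d → ℝ) : gradForm (g + h) = gradForm g + gradForm h := by
  simp [gradForm, add_smul, Finset.sum_add_distrib]

theorem gradForm_smul (c : ℝ) (g : Fin d → ℝ) : gradForm (c • g) = c • gradForm g := by
  simp [gradForm, mul_smul, Finset.smul_sum]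

/-- The Banach space `C¹(D)` of continuously differentiable functions on `D` that are bounded
together with their gradient, realized as pairs `(f, ∇f)` of bounded continuous functions, with
the supremum norm. -/
def C1Sub (D : Opens (EuclideanSpace ℝ (Fin d))) :
    Submodule ℝ ((D →ᵇ ℝ) × (Fin d → D →ᵇ ℝ)) where
  carrier := {w | ∀ x : D, HasFDerivAt (extendZero w.1) (gradForm fun k => w.2 k x)
    (x : EuclideanSpace ℝ (Fin d))}
  zero_mem' := fun x => by
    have h : extendZero ((0 : D →ᵇ ℝ) : D → ℝ) = 0 := extendZero_zero
    change HasFDerivAt (extendZero ((0 : D →ᵇ ℝ) : D → ℝ)) (gradForm (0 : Fin d → ℝ)) _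
    rw [h, gradForm_zero]
    exact hasFDerivAt_const 0 _
  add_mem' := fun {a b} h h' x => by
    change HasFDerivAt (extendZero ((a.1 : D → ℝ) + (b.1 : D → ℝ)))
      (gradForm ((fun k => a.2 k x) + fun k => b.2 k x)) _
    rw [extendZero_add, gradForm_add]
    exact (h x).add (h' x)
  smul_mem' := fun c a h x => by
    change HasFDerivAt (extendZero (c • (a.1 : D → ℝ))) (gradForm (c • fun k => a.2 k x)) _
    rw [extendZero_smul, gradForm_smul]
    exact (h x).const_smul c

/-- `C¹(D)` as a normed space. -/
abbrev C1 (D : Opens (EuclideanSpace ℝ (Fin d))) : Type := C1Sub D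

instance (D : Opens (EuclideanSpace ℝ (Fin d))) : NormedAddCommGroup (C1 D) :=
  inferInstanceAs (NormedAddCommGroup (C1Sub D))

instance (D : Opens (EuclideanSpace ℝ (Fin d))) : NormedSpace ℝ (C1 D) :=
  inferInstanceAs (NormedSpace ℝ (C1Sub D))

/-- The underlying function of `f ∈ C¹(D)`. -/
def C1.fn {D : Opens (EuclideanSpace ℝ (Fin d))} (w : C1 D) (x : D) : ℝ := w.1.1 x

/-- The partial derivative `∂f/∂x_k` of `f ∈ C¹(D)`. -/
def C1.grad {D : Opens (EuclideanSpace ℝ (Fin d))} (w : C1 D) (k : Fin d) (x : D) : ℝ :=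
  w.1.2 k x

/-! ### Matrix fields -/

/-- The value at `x` of a matrix field with entries in `C¹(D)`. -/
def matVal {D : Opens (EuclideanSpace ℝ (Fin d))} (ψ : Fin d → Fin d → C1 D) (x : D) :
    Matrix (Fin d) (Fin d) ℝ :=
  Matrix.of fun i j => (ψ i j).fn x

/-- The entrywise partial derivative `∂ψ/∂x_k` at `x`. -/
def matPartial {D : Opens (EuclideanSpace ℝ (Fin d))} (ψ : Fin d → Fin d → C1 D) (k : Fin d)
    (x : D) : Matrix (Fin d) (Fin d) ℝ :=
  Matrix.of fun i j => (ψ i j).grad k x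

/-- The matrix exponential `e^ψ` at `x`. -/
def expMat {D : Opens (EuclideanSpace ℝ (Fin d))} (ψ : Fin d → Fin d → C1 D) (x : D) :
    Matrix (Fin d) (Fin d) ℝ :=
  NormedSpace.exp (matVal ψ x)

/-- The matrix exponential `e^{-ψ}` at `x`. -/
def expNegMat {D : Opens (EuclideanSpace ℝ (Fin d))} (ψ : Fin d → Fin d → C1 D) (x : D) :
    Matrix (Fin d) (Fin d) ℝ :=
  NormedSpace.exp (-matVal ψ x)

/-- The `i`-th component `∑_j ∂(e^ψ)_{ij}/∂x_j` of `div e^ψ` at `x` (classical derivatives). -/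
def divExp {D : Opens (EuclideanSpace ℝ (Fin d))} (ψ : Fin d → Fin d → C1 D) (i : Fin d)
    (x : D) : ℝ :=
  ∑ j, fderiv ℝ (extendZero fun y : D => expMat ψ y i j)
    (x : EuclideanSpace ℝ (Fin d)) (basisVec j)

/-- The velocity gradient `(∇u)_{ij} = ∂u_i/∂x_j` at `x`. -/
def gradVel {D : Opens (EuclideanSpace ℝ (Fin d))} (u : Fin d → H2 D) (x : D) :
    Matrix (Fin d) (Fin d) ℝ :=
  Matrix.of fun i j => (u i).grad j x

/-- `Ω`, `B`, `N` decompose the matrix `G` relative to `σ`: `G = Ω + B + N σ⁻¹` with `Ω`, `N`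
antisymmetric and `B` symmetric and commuting with `σ`. -/
structure IsDecomposition (G σ Ω B N : Matrix (Fin d) (Fin d) ℝ) : Prop where
  antisymm_Ω : Ω.transpose = -Ω
  antisymm_N : N.transpose = -N
  symm_B : B.transpose = B
  commute : Commute B σ
  eq : G = Ω + B + N * σ⁻¹

/-! ### The log-conformation Oldroyd-B system -/

/-- The time interval `[0, T)`, where `T = +∞` is allowed. -/
def timeInterval (T : EReal) : Set ℝ := {t | 0 ≤ t ∧ (t : EReal) < T}

/-- `(u, p, ψ)` is a smooth solution on `[0, T) × D` of the log-formulation of the Oldroyd-B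
system with homogeneous Dirichlet boundary condition for `u`. Time derivatives are derivatives of
functions with values in `H²(D)^d` and `C¹(D)^{d × d}` (one-sided at `t = 0`). -/
structure IsSmoothSolution (D : Opens (EuclideanSpace ℝ (Fin d))) (Re Wi ε : ℝ) (T : EReal)
    (u : ℝ → Fin d → H2 D) (p : ℝ → H1 D) (ψ : ℝ → Fin d → Fin d → C1 D) : Prop where
  regular_u : ContDiffOn ℝ 1 u (timeInterval T)
  regular_p : ContinuousOn p (timeInterval T)
  regular_ψ : ContDiffOn ℝ 1 ψ (timeInterval T)
  dirichlet : ∀ t ∈ timeInterval T, ∀ i, (u t i).toH1 ∈ H10 D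
  symm_ψ : ∀ t ∈ timeInterval T, ∀ x : D, (matVal (ψ t) x).transpose = matVal (ψ t) x
  momentum : ∀ t ∈ timeInterval T, ∀ i, ∀ᵐ x : D,
    Re * ((derivWithin u (timeInterval T) t i).fn x + ∑ j, (u t j).fn x * (u t i).grad j x) =
      -(p t).grad i x + (1 - ε) * ∑ j, (u t i).hess j j x + ε / Wi * divExp (ψ t) i x
  incompressible : ∀ t ∈ timeInterval T, ∀ᵐ x : D, ∑ i, (u t i).grad i x = 0
  constitutive : ∀ t ∈ timeInterval T, ∀ᵐ x : D, ∃ Ω B N : Matrix (Fin d) (Fin d) ℝ,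
    IsDecomposition (gradVel (u t) x) (expMat (ψ t) x) Ω B N ∧
    matVal (derivWithin ψ (timeInterval T) t) x +
        ∑ k, (u t k).fn x • matPartial (ψ t) k x =
      Ω * matVal (ψ t) x - matVal (ψ t) x * Ω + (2 : ℝ) • B +
        (1 / Wi) • (expNegMat (ψ t) x - 1)

/-- `tr(e^ψ - ψ - I)` at `x`. -/
def entropyDensity {D : Opens (EuclideanSpace ℝ (Fin d))} (ψ : Fin d → Fin d → C1 D) (x : D) :
    ℝ :=
  (expMat ψ x - matVal ψ x - 1).trace

/-- `tr(e^ψ + e^{-ψ} - 2I)` at `x`. -/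
def dissipationDensity {D : Opens (EuclideanSpace ℝ (Fin d))} (ψ : Fin d → Fin d → C1 D)
    (x : D) : ℝ :=
  (expMat ψ x + expNegMat ψ x - (2 : ℝ) • (1 : Matrix (Fin d) (Fin d) ℝ)).trace

/-- The free energy `F(u, e^ψ) = Re/2 ∫ |u|² + ε/(2 Wi) ∫ tr(e^ψ - ψ - I)`. -/
def freeEnergy {D : Opens (EuclideanSpace ℝ (Fin d))} (Re Wi ε : ℝ) (u : Fin d → H2 D)
    (ψ : Fin d → Fin d → C1 D) : ℝ :=
  Re / 2 * (∫ x : D, ∑ i, (u i).fn x ^ 2) + ε / (2 * Wi) * ∫ x : D, entropyDensity ψ x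

/-- `∫ |∇u|²`. -/
def gradEnergy {D : Opens (EuclideanSpace ℝ (Fin d))} (u : Fin d → H2 D) : ℝ :=
  ∫ x : D, ∑ i, ∑ j, (u i).grad j x ^ 2

/-- The rate `min(2(1-ε)/(Re C), 1/Wi)`, understood as `1/Wi` when `Re = 0`. -/
def decayRate (C Re Wi ε : ℝ) : ℝ :=
  if Re = 0 then 1 / Wi else min (2 * (1 - ε) / (Re * C)) (1 / Wi)

end LogOldroydB

end

/-! ### Integration by parts, Sobolev and Poincaré inequalities for `H10`. -/

section SobolevTools

namespace LogOldroydB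

variable {d : ℕ} {D : Opens (EuclideanSpace ℝ (Fin d))}

/-! The energy identity comes from testing the momentum equation with u and the constitutive
equation with (ε/2Wi)(e^ψ - I), then adding. The multiplier e^ψ - I is the gradient of the entropy:
d tr(e^A - A - I) = tr((e^A - I) dA). The matrix exponential does not commute with its increment,
but the trace hides this (`fderiv_tracial_exp`). Hence the time derivative in the constitutive
equation gives the derivative of the entropy, and the transport term gives u · ∇ of the entropy
density.

Four cancellations remain. The pressure and the entropy transport are gradients tested with a
divergence free field (`sum_integral_partial_mul_eq_zero`). The convective term is skew-symmetric
(`integral_convective_eq_zero`). The commutator of Ω and ψ, and the antisymmetric parts Ω and N,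
have zero trace against e^ψ - I (`trace_constitutive`). The stress power ∫ e^ψ : ∇u left over then
has coefficient -ε/Wi in the kinetic balance and +ε/Wi in the entropy balance.

No regularity of ∂D is assumed, so there is no boundary trace: every integration by parts is proved
against test functions and carried to `H10` by density (`H10.integral_eq`). The convective term also
needs u in L⁴; this follows from the Sobolev inequality in dimension 2 or 3
(`H10.exists_eLpNorm_four_le`), which yields Poincaré as well.

For the decay, Poincaré bounds the kinetic energy by the viscous dissipation. The entropy density is
bounded by tr(e^ψ + e^{-ψ} - 2I), the difference being the nonnegative entropy density of -ψ. Thus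
F' ≤ -λF, and Grönwall concludes. -/

theorem isFiniteMeasure_of_isBounded
    (hD : Bornology.IsBounded (D : Set (EuclideanSpace ℝ (Fin d)))) :
    IsFiniteMeasure (volume : Measure D) := by
  constructor
  have h := (measurePreserving_subtype_coe (μa := (volume : Measure (EuclideanSpace ℝ (Fin d))))
    D.isOpen.measurableSet).measure_preimage (s := Set.univ) MeasurableSet.univ.nullMeasurableSet
  rw [Set.preimage_univ, Measure.restrict_apply_univ] at h
  exact (h.le.trans_lt hD.measure_lt_top : _)

/-! ### Passing from `D` to the whole space -/

theorem integral_opens_eq {f : EuclideanSpace ℝ (Fin d) → ℝ} (hf : ∀ x ∉ D, f x = 0) :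
    ∫ x : D, f x = ∫ x, f x := by
  refine (integral_subtype_comap D.isOpen.measurableSet f).trans ?_
  exact setIntegral_eq_integral_of_forall_compl_eq_zero hf

theorem integrable_opens_iff {f : EuclideanSpace ℝ (Fin d) → ℝ} (hf : ∀ x ∉ D, f x = 0) :
    Integrable (fun x : D => f x) ↔ Integrable f := by
  refine ((measurePreserving_subtype_coe D.isOpen.measurableSet).integrable_comp_emb
    (MeasurableEmbedding.subtype_coe D.isOpen.measurableSet) (g := f)).trans ?_
  refine integrableOn_iff_integrable_of_support_subset fun x hx => ?_
  by_contra h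
  exact hx (hf x h)

theorem testFunction_eq_zero (φ : TestFunction D ℝ ⊤) {x : EuclideanSpace ℝ (Fin d)}
    (hx : x ∉ D) : φ x = 0 :=
  image_eq_zero_of_notMem_tsupport fun h => hx (φ.tsupport_subset h)

theorem fderiv_testFunction_eq_zero (φ : TestFunction D ℝ ⊤) {x : EuclideanSpace ℝ (Fin d)}
    (hx : x ∉ D) : fderiv ℝ φ x = 0 :=
  image_eq_zero_of_notMem_tsupport fun h =>
    hx (φ.tsupport_subset (tsupport_fderiv_subset ℝ h))

theorem partialTest_eq_zero (φ : TestFunction D ℝ ⊤) (i : Fin d) {x : EuclideanSpace ℝ (Fin d)}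
    (hx : x ∉ D) : partialTest φ i x = 0 := by
  simp [partialTest, fderiv_testFunction_eq_zero φ hx]

theorem hasFDerivAt_testFunction (φ : TestFunction D ℝ ⊤) (x : EuclideanSpace ℝ (Fin d)) :
    HasFDerivAt φ (fderiv ℝ φ x) x :=
  ((φ.contDiff.differentiable (by simp)) x).hasFDerivAt

theorem continuous_partialTest (φ : TestFunction D ℝ ⊤) (i : Fin d) :
    Continuous (partialTest φ i) :=
  (φ.contDiff.continuous_fderiv (by simp)).clm_apply continuous_const

theorem hasCompactSupport_partialTest (φ : TestFunction D ℝ ⊤) (i : Fin d) :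
    HasCompactSupport (partialTest φ i) :=
  (φ.hasCompactSupport.fderiv (𝕜 := ℝ)).comp_left
    (g := fun L : EuclideanSpace ℝ (Fin d) →L[ℝ] ℝ => L (basisVec i)) (by simp)

theorem memLp_test (φ : TestFunction D ℝ ⊤) {p : ℝ≥0∞} :
    MemLp (fun x : D => φ x) p (volume : Measure D) :=
  (((φ.continuous.memLp_of_hasCompactSupport (μ := volume) φ.hasCompactSupport).restrict
    (D : Set (EuclideanSpace ℝ (Fin d))))).comp_measurePreserving
      (measurePreserving_subtype_coe D.isOpen.measurableSet)

theorem memLp_partialTest (φ : TestFunction D ℝ ⊤) (i : Fin d) {p : ℝ≥0∞} :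
    MemLp (fun x : D => partialTest φ i x) p (volume : Measure D) :=
  ((((continuous_partialTest φ i).memLp_of_hasCompactSupport (μ := volume)
    (hasCompactSupport_partialTest φ i)).restrict
    (D : Set (EuclideanSpace ℝ (Fin d))))).comp_measurePreserving
      (measurePreserving_subtype_coe D.isOpen.measurableSet)

/-- The product of two test functions. -/
noncomputable def testMul (φ χ : TestFunction D ℝ ⊤) : TestFunction D ℝ ⊤ where
  toFun := fun x => φ x * χ x
  contDiff' := φ.contDiff.mul χ.contDiff
  hasCompactSupport' := φ.hasCompactSupport.mul_right
  tsupport_subset' := tsupport_mul_subset_left.trans φ.tsupport_subset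

theorem partialTest_testMul (φ χ : TestFunction D ℝ ⊤) (i : Fin d)
    (x : EuclideanSpace ℝ (Fin d)) :
    partialTest (testMul φ χ) i x = φ x * partialTest χ i x + partialTest φ i x * χ x := by
  have h : HasFDerivAt (testMul φ χ) _ x :=
    (hasFDerivAt_testFunction φ x).mul (hasFDerivAt_testFunction χ x)
  simp only [partialTest, h.fderiv]
  simp [mul_comm]

/-- Integration by parts of a classically differentiable function against a test function. -/
theorem integral_mul_partialTest_of_hasLineDerivAt {f f' : D → ℝ} (i : Fin d)
    (hf : MemLp f 2) (hf' : MemLp f' 2)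
    (h : ∀ x : D, HasLineDerivAt ℝ (extendZero f) (f' x) (x : EuclideanSpace ℝ (Fin d))
      (basisVec i)) (φ : TestFunction D ℝ ⊤) :
    ∫ x : D, f x * partialTest φ i x = -∫ x : D, f' x * φ x := by
  have hval : ∀ (g : D → ℝ) (x : D), extendZero g x = g x := fun g x =>
    Subtype.val_injective.extend_apply g 0 x
  have hz : ∀ (g : D → ℝ), ∀ x ∉ D, extendZero g x * φ x = 0 := fun g x hx => by
    rw [testFunction_eq_zero φ hx, mul_zero]
  have hz' : ∀ x ∉ D, extendZero f x * partialTest φ i x = 0 := fun x hx => by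
    rw [partialTest_eq_zero φ i hx, mul_zero]
  have key := integral_bilinear_hasLineDerivAt_right_eq_neg_left_of_integrable
    (μ := (volume : Measure (EuclideanSpace ℝ (Fin d)))) (B := ContinuousLinearMap.mul ℝ ℝ)
    (f := extendZero f) (f' := extendZero f') (g := φ) (g' := partialTest φ i)
    (v := basisVec i) ?_ ?_ ?_ ?_ ?_
  · simp only [ContinuousLinearMap.mul_apply'] at key
    rw [← integral_opens_eq hz', ← integral_opens_eq (hz f')] at key
    simpa only [hval] using key
  · refine (integrable_opens_iff (hz f')).1 ?_
    simp only [hval]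
    exact hf'.integrable_mul (memLp_test φ (p := 2))
  · refine (integrable_opens_iff hz').1 ?_
    simp only [hval]
    exact hf.integrable_mul (memLp_partialTest φ i (p := 2))
  · refine (integrable_opens_iff (hz f)).1 ?_
    simp only [hval]
    exact hf.integrable_mul (memLp_test φ (p := 2))
  -- Differentiability of the zero extension is needed only on the support of φ, inside D, so a jump
  -- across ∂D is harmless.
  · intro x hx
    have := h ⟨x, φ.tsupport_subset hx⟩
    rwa [← hval f'] at this
  · intro x _
    exact (hasFDerivAt_testFunction φ x).hasLineDerivAt _

/-! ### Duality with `H¹₀(D)` -/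

theorem inner_toLp_eq {f : D → ℝ} (hf : MemLp f 2) (g : L2 D) :
    inner ℝ (hf.toLp f) g = ∫ x : D, f x * g x := by
  rw [L2.inner_def]
  refine integral_congr_ae ?_
  filter_upwards [hf.coeFn_toLp] with x hx
  rw [hx]
  simp [mul_comm]

theorem inner_L2_eq (f g : L2 D) : inner ℝ f g = ∫ x : D, f x * g x := by
  rw [L2.inner_def]
  simp [mul_comm]

theorem continuous_fn : Continuous (H1.fn : H1 D → L2 D) :=
  continuous_fst.comp continuous_subtype_val

theorem continuous_grad (j : Fin d) : Continuous (fun w : H1 D => w.grad j) :=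
  (continuous_apply j).comp (continuous_snd.comp continuous_subtype_val)

/-- If `div F = h` weakly, with `F` and `h` square integrable, then the integration by parts
formula extends from test functions to `H¹₀(D)`. -/
theorem H10.integral_eq {F : Fin d → D → ℝ} {h : D → ℝ} (hF : ∀ j, MemLp (F j) 2)
    (hh : MemLp h 2)
    (hφ : ∀ φ : TestFunction D ℝ ⊤,
      ∑ j, ∫ x : D, F j x * partialTest φ j x = -∫ x : D, h x * φ x)
    {w : H1 D} (hw : w ∈ H10 D) :
    ∑ j, ∫ x : D, F j x * w.grad j x = -∫ x : D, h x * w.fn x := by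
  -- Both sides are L² inner products with fixed functions, continuous in w for the H¹ norm. The
  -- identity therefore defines a closed set and passes from test functions to their closure.
  have hcl : IsClosed {w : H1 D | ∑ j, inner ℝ ((hF j).toLp (F j)) (w.grad j) =
      -inner ℝ (hh.toLp h) w.fn} := by
    refine isClosed_eq ?_ ?_
    · exact continuous_finsetSum _ fun j _ => continuous_const.inner (continuous_grad j)
    · exact (continuous_const.inner continuous_fn).neg
  have hmem : w ∈ {w : H1 D | ∑ j, inner ℝ ((hF j).toLp (F j)) (w.grad j) =
      -inner ℝ (hh.toLp h) w.fn} := by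
    refine closure_minimal ?_ hcl hw
    rintro w ⟨φ, h1, h2⟩
    simp only [Set.mem_ofPred_eq, inner_toLp_eq]
    have e1 : ∫ x : D, h x * w.fn x = ∫ x : D, h x * φ x := integral_congr_ae <| by
      filter_upwards [h1] with x hx
      rw [hx]
    have e2 : ∀ j, ∫ x : D, F j x * w.grad j x = ∫ x : D, F j x * partialTest φ j x :=
      fun j => integral_congr_ae <| by
        filter_upwards [h2 j] with x hx
        rw [hx]
    simp only [e1, e2, hφ]
  simpa only [Set.mem_ofPred_eq, inner_toLp_eq] using hmem

/-- Integration by parts of one partial derivative against `H¹₀(D)`. -/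
theorem H10.integral_mul_grad {f f' : D → ℝ} (i : Fin d) (hf : MemLp f 2) (hf' : MemLp f' 2)
    (h : ∀ φ : TestFunction D ℝ ⊤, ∫ x : D, f x * partialTest φ i x = -∫ x : D, f' x * φ x)
    {w : H1 D} (hw : w ∈ H10 D) :
    ∫ x : D, f x * w.grad i x = -∫ x : D, f' x * w.fn x := by
  have key := H10.integral_eq (F := fun j => if j = i then f else 0) (h := f')
    (fun j => by split_ifs; exacts [hf, MemLp.zero]) hf' (fun φ => by
      rw [← h φ, Finset.sum_eq_single i (fun j _ hj => by simp [hj]) (by simp)]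
      simp) hw
  rw [← key, Finset.sum_eq_single i (fun j _ hj => by simp [hj]) (by simp)]
  simp

/-! ### Sobolev and Poincaré inequalities on `H¹₀(D)` -/

theorem opNorm_le_sum_basisVec (L : EuclideanSpace ℝ (Fin d) →L[ℝ] ℝ) :
    ‖L‖ ≤ ∑ j, ‖L (basisVec j)‖ := by
  refine L.opNorm_le_bound (Finset.sum_nonneg fun _ _ => norm_nonneg _) fun x => ?_
  have hx : x = ∑ j, x j • (basisVec j : EuclideanSpace ℝ (Fin d)) := by
    have := (EuclideanSpace.basisFun (Fin d) ℝ).sum_repr x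
    simpa [basisVec] using this.symm
  calc ‖L x‖ = ‖∑ j, x j • L (basisVec j)‖ := by
        conv_lhs => rw [hx]
        simp only [map_sum, map_smul]
    _ ≤ ∑ j, ‖x j • L (basisVec j)‖ := norm_sum_le _ _
    _ ≤ ∑ j, ‖L (basisVec j)‖ * ‖x‖ := by
        refine Finset.sum_le_sum fun j _ => ?_
        rw [norm_smul, mul_comm]
        gcongr
        exact PiLp.norm_apply_le x j
    _ = _ := by rw [Finset.sum_mul]

/-- Gagliardo–Nirenberg–Sobolev on a bounded set with gradient exponent p = 12/7, followed by Hölder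
from L^p to L² on D. This p serves both dimensions: p < 2 ≤ d, while 1/p - 1/d is 1/12 for d = 2 and
exactly 1/4 for d = 3. The exponent 2 itself is excluded when d = 2, where p < d is required. -/
theorem exists_eLpNorm_four_test_le (hd : d = 2 ∨ d = 3)
    (hD : Bornology.IsBounded (D : Set (EuclideanSpace ℝ (Fin d)))) :
    ∃ K : ℝ≥0∞, K ≠ ∞ ∧ ∀ φ : TestFunction D ℝ ⊤,
      eLpNorm (fun x : D => φ x) 4 volume ≤
        K * ∑ j, eLpNorm (fun x : D => partialTest φ j x) 2 volume := by
  obtain ⟨p, hp⟩ : ∃ p : NNReal, (p : ℝ) = 12 / 7 := ⟨12 / 7, by simp⟩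
  have hrank : (Module.finrank ℝ (EuclideanSpace ℝ (Fin d)) : ℝ) = d := by simp
  refine ⟨eLpNormLESNormFDerivOfLeConst ℝ (volume : Measure (EuclideanSpace ℝ (Fin d)))
      (D : Set (EuclideanSpace ℝ (Fin d))) p 4 *
    (volume.restrict (D : Set (EuclideanSpace ℝ (Fin d)))) Set.univ ^
      (1 / (p : ℝ≥0∞).toReal - 1 / (2 : ℝ≥0∞).toReal),
    ?_, fun φ => ?_⟩
  · refine ENNReal.mul_ne_top ENNReal.coe_ne_top (ENNReal.rpow_ne_top_of_nonneg ?_ ?_)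
    · rw [ENNReal.coe_toReal, hp]
      norm_num
    · rw [Measure.restrict_apply_univ]
      exact hD.measure_lt_top.ne
  have hmp := measurePreserving_subtype_coe
    (μa := (volume : Measure (EuclideanSpace ℝ (Fin d)))) D.isOpen.measurableSet
  have hcf : Continuous (fderiv ℝ φ) := φ.contDiff.continuous_fderiv (by simp)
  have h1 : eLpNorm (fun x : D => φ x) 4 volume ≤
      eLpNorm φ 4 (volume : Measure (EuclideanSpace ℝ (Fin d))) := by
    have := eLpNorm_comp_measurePreserving (p := 4) (g := (φ : EuclideanSpace ℝ (Fin d) → ℝ))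
      φ.continuous.aestronglyMeasurable hmp
    exact this.le.trans (eLpNorm_mono_measure _ Measure.restrict_le_self)
  have h2 : eLpNorm φ 4 (volume : Measure (EuclideanSpace ℝ (Fin d))) ≤
      eLpNormLESNormFDerivOfLeConst ℝ (volume : Measure (EuclideanSpace ℝ (Fin d)))
      (D : Set (EuclideanSpace ℝ (Fin d))) p 4 *
        eLpNorm (fderiv ℝ φ) p volume := by
    refine eLpNorm_le_eLpNorm_fderiv_of_le (q := 4) volume (φ.contDiff.of_le (by simp))
      ?_ ?_ ?_ ?_ hD
    · intro x hx
      by_contra h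
      exact hx (testFunction_eq_zero φ h)
    · rw [← NNReal.coe_le_coe, hp]; norm_num
    · rw [← NNReal.coe_lt_coe, hp, NNReal.coe_natCast, hrank]
      rcases hd with rfl | rfl <;> norm_num
    · rw [NNReal.coe_inv, hp, hrank]
      rcases hd with rfl | rfl <;> norm_num
  have h3 : eLpNorm (fderiv ℝ φ) p (volume : Measure (EuclideanSpace ℝ (Fin d))) =
      eLpNorm (fderiv ℝ φ) p (volume.restrict (D : Set (EuclideanSpace ℝ (Fin d)))) := by
    have hs : Function.support (fun x => ‖fderiv ℝ φ x‖) ⊆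
        (D : Set (EuclideanSpace ℝ (Fin d))) := by
      intro x hx
      by_contra h
      exact hx (by simp [fderiv_testFunction_eq_zero φ h])
    rw [← eLpNorm_norm, ← eLpNorm_norm (μ := volume.restrict _)]
    exact (eLpNorm_restrict_eq_of_support_subset hs).symm
  have h4 := eLpNorm_le_eLpNorm_mul_rpow_measure_univ (p := p) (q := 2)
    (f := fderiv ℝ φ) (μ := volume.restrict (D : Set (EuclideanSpace ℝ (Fin d)))) (by
      rw [show (2 : ℝ≥0∞) = ((2 : NNReal) : ℝ≥0∞) from rfl, ENNReal.coe_le_coe,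
        ← NNReal.coe_le_coe, hp]
      norm_num) hcf.aestronglyMeasurable
  have h5 : eLpNorm (fderiv ℝ φ) 2 (volume.restrict (D : Set (EuclideanSpace ℝ (Fin d)))) ≤
      ∑ j, eLpNorm (fun x : D => partialTest φ j x) 2 volume := by
    calc eLpNorm (fderiv ℝ φ) 2 (volume.restrict (D : Set (EuclideanSpace ℝ (Fin d))))
        ≤ eLpNorm (∑ j, fun x => ‖partialTest φ j x‖) 2
            (volume.restrict (D : Set (EuclideanSpace ℝ (Fin d)))) := by
          refine eLpNorm_mono_real fun x => ?_
          rw [Finset.sum_apply]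
          exact opNorm_le_sum_basisVec _
      _ ≤ ∑ j, eLpNorm (fun x => ‖partialTest φ j x‖) 2
            (volume.restrict (D : Set (EuclideanSpace ℝ (Fin d)))) :=
          eLpNorm_sum_le (fun j _ =>
            (continuous_partialTest φ j).norm.aestronglyMeasurable) (by norm_num)
      _ = _ := by
          refine Finset.sum_congr rfl fun j _ => ?_
          rw [eLpNorm_norm]
          exact (eLpNorm_comp_measurePreserving (p := 2)
            (continuous_partialTest φ j).aestronglyMeasurable hmp).symm
  refine (h1.trans h2).trans ?_
  rw [h3, mul_assoc]
  gcongr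
  rw [mul_comm]
  exact h4.trans (by gcongr)

/-- The L⁴ norm is not continuous for L² convergence, but it is lower semicontinuous under
convergence in measure, which L² convergence implies. The right side is continuous on H¹, so the
bound for test functions survives in the closure. -/
theorem H10.exists_eLpNorm_four_le (hd : d = 2 ∨ d = 3)
    (hD : Bornology.IsBounded (D : Set (EuclideanSpace ℝ (Fin d)))) :
    ∃ K : ℝ≥0∞, K ≠ ∞ ∧ ∀ w ∈ H10 D,
      eLpNorm w.fn 4 volume ≤ K * ∑ j, eLpNorm (w.grad j) 2 volume := by
  obtain ⟨K, hK, h⟩ := exists_eLpNorm_four_test_le hd hD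
  refine ⟨K, hK, fun w hw => ?_⟩
  have := mem_closure_iff_nhdsWithin_neBot.1 hw
  have hcont : Filter.Tendsto (fun v : H1 D => K * ∑ j, eLpNorm (v.grad j) 2 volume) (nhds w)
      (nhds (K * ∑ j, eLpNorm (w.grad j) 2 volume)) := by
    refine ENNReal.Tendsto.const_mul (tendsto_finsetSum _ fun j _ => ?_) (Or.inr hK)
    have e : ∀ f : L2 D, eLpNorm f 2 volume = ‖f‖ₑ := fun f => (Lp.enorm_def f).symm
    simp only [e]
    exact ((continuous_grad j).enorm).tendsto w
  -- Any C above the right side at w still bounds the right side near w; lower semicontinuity needs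
  -- such a constant bound.
  refine le_of_forall_gt_imp_ge_of_dense fun C hC => ?_
  refine eLpNorm_le_of_tendstoInMeasure (u := nhdsWithin w
    {w | ∃ φ : TestFunction D ℝ ⊤, (∀ᵐ x : D, w.fn x = φ x) ∧
      ∀ i, ∀ᵐ x : D, w.grad i x = partialTest φ i x}) ?_ (tendstoInMeasure_of_tendsto_Lp
    ((continuous_fn.tendsto w).mono_left nhdsWithin_le_nhds)) fun i => Lp.aestronglyMeasurable _
  filter_upwards [self_mem_nhdsWithin, nhdsWithin_le_nhds (hcont.eventually_lt_const hC)]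
    with v hv hvC
  obtain ⟨φ, h1, h2⟩ := hv
  refine le_trans ?_ hvC.le
  rw [eLpNorm_congr_ae (show (v.fn : D → ℝ) =ᵐ[volume] fun x : D => φ x from h1),
    Finset.sum_congr rfl fun j _ => eLpNorm_congr_ae
      (show (v.grad j : D → ℝ) =ᵐ[volume] fun x : D => partialTest φ j x from h2 j)]
  exact h φ

theorem H10.memLp_four (hd : d = 2 ∨ d = 3)
    (hD : Bornology.IsBounded (D : Set (EuclideanSpace ℝ (Fin d)))) {w : H1 D}
    (hw : w ∈ H10 D) : MemLp w.fn 4 volume := by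
  obtain ⟨K, hK, h⟩ := H10.exists_eLpNorm_four_le hd hD
  refine ⟨Lp.aestronglyMeasurable _, (h w hw).trans_lt ?_⟩
  exact ENNReal.mul_lt_top hK.lt_top (ENNReal.sum_lt_top.2 fun j _ => (Lp.memLp _).2)

theorem integral_sq_eq_norm (f : L2 D) : ∫ x : D, f x ^ 2 = ‖f‖ ^ 2 := by
  rw [← real_inner_self_eq_norm_sq, inner_L2_eq]
  simp only [sq]

theorem integrable_sq (f : L2 D) : Integrable (fun x : D => f x ^ 2) :=
  (Lp.memLp f).integrable_sq

theorem H10.exists_poincare (hd : d = 2 ∨ d = 3)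
    (hD : Bornology.IsBounded (D : Set (EuclideanSpace ℝ (Fin d)))) :
    ∃ C : ℝ, 0 < C ∧ ∀ w ∈ H10 D,
      ∫ x : D, w.fn x ^ 2 ≤ C * ∑ j, ∫ x : D, w.grad j x ^ 2 := by
  obtain ⟨K, hK, h⟩ := H10.exists_eLpNorm_four_le hd hD
  have := isFiniteMeasure_of_isBounded hD
  set M : ℝ≥0∞ := K * (volume : Measure D) Set.univ ^
    (1 / (2 : ℝ≥0∞).toReal - 1 / (4 : ℝ≥0∞).toReal)
  have hM : M ≠ ∞ := ENNReal.mul_ne_top hK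
    (ENNReal.rpow_ne_top_of_nonneg (by norm_num) (measure_ne_top _ _))
  -- The factor d is the Cauchy–Schwarz cost of replacing the square of a sum by the sum of squares;
  -- the +1 keeps the constant positive even if D is empty.
  refine ⟨M.toReal ^ 2 * d + 1, by positivity, fun w hw => ?_⟩
  have h1 : eLpNorm w.fn 2 volume ≤ M * ∑ j, eLpNorm (w.grad j) 2 volume := by
    refine (eLpNorm_le_eLpNorm_mul_rpow_measure_univ (p := 2) (q := 4) (by norm_num)
      (Lp.aestronglyMeasurable _)).trans ?_
    calc _ ≤ _ := mul_le_mul_left (h w hw) _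
      _ = _ := by simp only [M]; ring
  have h2 : ‖w.fn‖ ≤ M.toReal * ∑ j, ‖w.grad j‖ := by
    have := ENNReal.toReal_mono (ENNReal.mul_ne_top hM
      (ENNReal.sum_ne_top.2 fun j _ => (Lp.memLp _).2.ne)) h1
    rwa [ENNReal.toReal_mul, ENNReal.toReal_sum fun j _ => (Lp.memLp _).2.ne] at this
  simp only [integral_sq_eq_norm]
  calc ‖w.fn‖ ^ 2 ≤ (M.toReal * ∑ j, ‖w.grad j‖) ^ 2 := by gcongr
    _ = M.toReal ^ 2 * (∑ j, ‖w.grad j‖) ^ 2 := by ring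
    _ ≤ M.toReal ^ 2 * (d * ∑ j, ‖w.grad j‖ ^ 2) := by
        gcongr
        simpa using sq_sum_le_card_mul_sum_sq (s := Finset.univ) (f := fun j => ‖w.grad j‖)
    _ ≤ _ := by
        have : 0 ≤ ∑ j, ‖w.grad j‖ ^ 2 := Finset.sum_nonneg fun _ _ => by positivity
        nlinarith

end LogOldroydB

end SobolevTools

/-! ### Differential of the exponential under a tracial functional. -/

section TracialExponential

namespace LogOldroydB

variable {𝔸 : Type*} [NormedRing 𝔸] [NormedAlgebra ℝ 𝔸]

/-- The differential of `τ (f ^ m)` for a tracial functional `τ`. -/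
theorem fderiv_tracial_pow {τ : 𝔸 →L[ℝ] ℝ} (hτ : ∀ a b, τ (a * b) = τ (b * a)) {f : 𝔸 → 𝔸}
    {f' : 𝔸 →L[ℝ] 𝔸} {a : 𝔸} (hf : HasFDerivAt f f' a) (m : ℕ) (h : 𝔸) :
    fderiv ℝ (fun x => τ (f x ^ m)) a h = m * τ (f a ^ (m - 1) * f' h) := by
  have h1 : HasFDerivAt (fun x => τ (f x ^ m)) _ a := τ.hasFDerivAt.comp a (hf.fun_pow' m)
  rw [h1.fderiv]
  simp only [ContinuousLinearMap.comp_apply, sum_apply, map_sum]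
  -- The Leibniz terms differ only in the position of `f' h` among the factors `f a`; cyclicity of τ
  -- makes all m of them equal.
  rw [Finset.sum_congr rfl (g := fun _ => τ (f a ^ (m - 1) * f' h))]
  · simp
  · intro i hi
    have hi' : m.pred - i + i = m - 1 := by
      have := Finset.mem_range.1 hi
      simp only [Nat.pred_eq_sub_one]
      omega
    simp only [smul_apply, smul_eq_mul, MulOpposite.smul_eq_mul_unop, MulOpposite.unop_op]
    rw [hτ, ← mul_assoc, ← pow_add, add_comm, hi']

variable [CompleteSpace 𝔸]

theorem contDiff_normedSpace_exp {n : WithTop ℕ∞} :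
    ContDiff ℝ n (NormedSpace.exp : 𝔸 → 𝔸) :=
  contDiff_iff_contDiffAt.2 fun a => (NormedSpace.exp_analytic (𝕂 := ℝ) a).contDiffAt

/-- `d τ(e^a) = τ(e^a da)` for a tracial functional `τ`. -/
theorem fderiv_tracial_exp {τ : 𝔸 →L[ℝ] ℝ} (hτ : ∀ a b, τ (a * b) = τ (b * a)) (a h : 𝔸) :
    fderiv ℝ (fun x : 𝔸 => τ (NormedSpace.exp x)) a h = τ (NormedSpace.exp a * h) := by
  let _ : NormedAlgebra ℚ 𝔸 := NormedAlgebra.restrictScalars ℚ ℝ 𝔸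
  have hexp : ∀ x : 𝔸, HasFDerivAt NormedSpace.exp (fderiv ℝ NormedSpace.exp x) x := fun x =>
    ((contDiff_normedSpace_exp (n := 1)).differentiable (by simp) x).hasFDerivAt
  -- Writing e^x = (e^{x/(m+1)})^{m+1}, the power rule expresses the same derivative through D exp
  -- at a/(m+1), for every m. As m → ∞ this base point tends to 0, where D exp is the identity.
  have key : ∀ m : ℕ, fderiv ℝ (fun x : 𝔸 => τ (NormedSpace.exp x)) a h =
      τ (NormedSpace.exp (((m : ℝ) / ((m : ℝ) + 1)) • a) *
        fderiv ℝ NormedSpace.exp ((1 / ((m : ℝ) + 1)) • a) h) := by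
    intro m
    have hm : (m : ℝ) + 1 ≠ 0 := by positivity
    have e : (fun x : 𝔸 => τ (NormedSpace.exp x)) =
        fun x => τ (NormedSpace.exp ((1 / ((m : ℝ) + 1)) • x) ^ (m + 1)) := by
      funext x
      rw [← NormedSpace.exp_nsmul, ← Nat.cast_smul_eq_nsmul ℝ, smul_smul]
      push_cast
      rw [mul_one_div_cancel hm, one_smul]
    have hs : HasFDerivAt (fun x : 𝔸 => (1 / ((m : ℝ) + 1)) • x)
        ((1 / ((m : ℝ) + 1)) • ContinuousLinearMap.id ℝ 𝔸) a :=
      (hasFDerivAt_id a).const_smul (1 / ((m : ℝ) + 1))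
    have hf : HasFDerivAt (fun x : 𝔸 => NormedSpace.exp ((1 / ((m : ℝ) + 1)) • x)) _ a :=
      (hexp _).comp a hs
    rw [e, fderiv_tracial_pow hτ hf]
    simp only [ContinuousLinearMap.comp_apply, smul_apply,
      ContinuousLinearMap.id_apply, map_smul, mul_smul_comm, smul_eq_mul, Nat.add_sub_cancel]
    rw [← mul_assoc]
    push_cast
    rw [mul_one_div_cancel hm, one_mul, ← NormedSpace.exp_nsmul, ← Nat.cast_smul_eq_nsmul ℝ,
      smul_smul, mul_one_div]
  have hc : Continuous fun q : ℝ × ℝ => τ (NormedSpace.exp (q.1 • a) *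
      fderiv ℝ NormedSpace.exp (q.2 • a) h) := by
    refine τ.continuous.comp (Continuous.mul ?_ ?_)
    · exact (contDiff_normedSpace_exp (n := 0)).continuous.comp (by fun_prop)
    · exact (((contDiff_normedSpace_exp (n := 1)).continuous_fderiv (by simp)).comp
        (by fun_prop)).clm_apply continuous_const
  have hlim : Filter.Tendsto (fun m : ℕ => ((m : ℝ) / ((m : ℝ) + 1), 1 / ((m : ℝ) + 1)))
      Filter.atTop (nhds ((1 : ℝ), (0 : ℝ))) :=
    (tendsto_natCast_div_add_atTop (1 : ℝ)).prodMk_nhds tendsto_one_div_add_atTop_nhds_zero_nat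
  have hlim2 := (hc.tendsto (1, 0)).comp hlim
  have h0 : fderiv ℝ NormedSpace.exp (0 : 𝔸) = 1 := (hasFDerivAt_exp_zero (𝕂 := ℝ)).fderiv
  have := tendsto_nhds_unique (tendsto_const_nhds.congr key) hlim2
  simpa [h0] using this

end LogOldroydB

end TracialExponential

/-! ### Differentials of trace functions of matrices. -/

section MatrixExponential

attribute [local instance] Matrix.linftyOpNormedRing Matrix.linftyOpNormedAlgebra

namespace LogOldroydB

variable {d : ℕ}

theorem contDiff_matrix_exp {n : WithTop ℕ∞} :
    ContDiff ℝ n (NormedSpace.exp : Matrix (Fin d) (Fin d) ℝ → Matrix (Fin d) (Fin d) ℝ) :=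
  contDiff_normedSpace_exp

/-- The trace as a continuous linear map. -/
noncomputable def traceCLM (d : ℕ) : Matrix (Fin d) (Fin d) ℝ →L[ℝ] ℝ :=
  (Matrix.traceLinearMap (Fin d) ℝ ℝ).toContinuousLinearMap

/-- `d tr(e^A) = tr(e^A dA)`. -/
theorem fderiv_trace_exp (A H : Matrix (Fin d) (Fin d) ℝ) :
    fderiv ℝ (fun X : Matrix (Fin d) (Fin d) ℝ => (NormedSpace.exp X).trace) A H =
      (NormedSpace.exp A * H).trace :=
  fderiv_tracial_exp (τ := traceCLM d) Matrix.trace_mul_comm A H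

theorem contDiff_trace_exp {n : WithTop ℕ∞} :
    ContDiff ℝ n (fun X : Matrix (Fin d) (Fin d) ℝ => (NormedSpace.exp X).trace) :=
  (traceCLM d).contDiff.comp contDiff_matrix_exp

theorem contDiff_exp_entry {n : WithTop ℕ∞} (i j : Fin d) :
    ContDiff ℝ n (fun X : Matrix (Fin d) (Fin d) ℝ => NormedSpace.exp X i j) :=
  ((Matrix.entryLinearMap ℝ ℝ i j).toContinuousLinearMap).contDiff.comp contDiff_matrix_exp

theorem contDiff_trace_exp_sub {n : WithTop ℕ∞} :
    ContDiff ℝ n (fun X : Matrix (Fin d) (Fin d) ℝ => (NormedSpace.exp X - X - 1).trace) :=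
  (traceCLM d).contDiff.comp ((contDiff_matrix_exp.sub contDiff_id).sub contDiff_const)

theorem fderiv_trace_exp_sub (A H : Matrix (Fin d) (Fin d) ℝ) :
    fderiv ℝ (fun X : Matrix (Fin d) (Fin d) ℝ => (NormedSpace.exp X - X - 1).trace) A H =
      ((NormedSpace.exp A - 1) * H).trace := by
  have h1 : HasFDerivAt (fun X : Matrix (Fin d) (Fin d) ℝ => (NormedSpace.exp X).trace)
      _ A := ((contDiff_trace_exp (n := 1)).differentiable (by simp) A).hasFDerivAt
  have h2 := (h1.sub (traceCLM d).hasFDerivAt).sub_const ((1 : Matrix (Fin d) (Fin d) ℝ).trace)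
  have h3 : HasFDerivAt
      (fun X : Matrix (Fin d) (Fin d) ℝ => (NormedSpace.exp X - X - 1).trace) _ A :=
    h2.congr_of_eventuallyEq (Filter.Eventually.of_forall fun X => by
      change (NormedSpace.exp X - X - 1).trace = (NormedSpace.exp X).trace - X.trace - _
      rw [Matrix.trace_sub, Matrix.trace_sub])
  rw [h3.fderiv, sub_mul, one_mul, Matrix.trace_sub, ← fderiv_trace_exp]
  rfl

end LogOldroydB

end MatrixExponential

/-! ### Trace inequalities and the algebra of the constitutive law. -/

section MatrixAlgebra

namespace LogOldroydB

variable {d : ℕ}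

/-- Diagonalization reduces the trace to the sum of e^v - v - 1 over the eigenvalues v, and e^v ≥ 1
+ v. -/
theorem trace_exp_sub_sub_one_nonneg {A : Matrix (Fin d) (Fin d) ℝ} (hA : A.transpose = A) :
    0 ≤ (NormedSpace.exp A - A - 1).trace := by
  have hH : A.IsHermitian := by
    rw [Matrix.IsHermitian, Matrix.conjTranspose_eq_transpose_of_trivial, hA]
  obtain ⟨U, v, hU⟩ : ∃ (U : (Matrix (Fin d) (Fin d) ℝ)ˣ) (v : Fin d → ℝ),
      A = U * Matrix.diagonal v * (↑U⁻¹ : Matrix (Fin d) (Fin d) ℝ) :=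
    ⟨Unitary.toUnits hH.eigenvectorUnitary, hH.eigenvalues, hH.spectral_theorem⟩
  have hexp : NormedSpace.exp A =
      U * Matrix.diagonal (fun i => Real.exp (v i)) * (↑U⁻¹ : Matrix (Fin d) (Fin d) ℝ) := by
    rw [hU, Matrix.exp_units_conj, Matrix.exp_diagonal]
    congr 3
    funext i
    rw [Pi.exp_def, Real.exp_eq_exp_ℝ]
  have htr : ∀ M : Matrix (Fin d) (Fin d) ℝ,
      (U * M * (↑U⁻¹ : Matrix (Fin d) (Fin d) ℝ)).trace = M.trace := fun M => by
    rw [Matrix.trace_mul_comm, ← mul_assoc, Units.inv_mul, one_mul]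
  rw [Matrix.trace_sub, Matrix.trace_sub, hexp, htr, congrArg Matrix.trace hU, htr,
    ← Matrix.diagonal_one, Matrix.trace_diagonal, Matrix.trace_diagonal,
    Matrix.trace_diagonal, ← Finset.sum_sub_distrib, ← Finset.sum_sub_distrib]
  exact Finset.sum_nonneg fun i _ => by linarith [Real.add_one_le_exp (v i)]

theorem trace_mul_eq_zero_of_symm_antisymm {S W : Matrix (Fin d) (Fin d) ℝ}
    (hS : S.transpose = S) (hW : W.transpose = -W) : (S * W).trace = 0 := by
  have h : (S * W).trace = -(S * W).trace := by
    conv_lhs => rw [← Matrix.trace_transpose, Matrix.transpose_mul, hS, hW, neg_mul,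
      Matrix.trace_neg, Matrix.trace_mul_comm]
  linarith

theorem exp_neg_mul_exp (A : Matrix (Fin d) (Fin d) ℝ) :
    NormedSpace.exp A * NormedSpace.exp (-A) = 1 := by
  rw [Matrix.exp_neg]
  exact Matrix.mul_nonsing_inv _ ((Matrix.isUnit_iff_isUnit_det _).1 (Matrix.isUnit_exp A))

/-- The algebraic identity behind the free energy estimate. -/
theorem trace_constitutive {A G Ω B N : Matrix (Fin d) (Fin d) ℝ} (c : ℝ)
    (hA : A.transpose = A) (hG : G.trace = 0)
    (h : IsDecomposition G (NormedSpace.exp A) Ω B N) :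
    ((NormedSpace.exp A - 1) * (Ω * A - A * Ω + (2 : ℝ) • B +
      c • (NormedSpace.exp (-A) - 1))).trace =
      2 * (NormedSpace.exp A * G).trace -
        c * (NormedSpace.exp A + NormedSpace.exp (-A) -
          (2 : ℝ) • (1 : Matrix (Fin d) (Fin d) ℝ)).trace := by
  have hσ : (NormedSpace.exp A).transpose = NormedSpace.exp A := by
    rw [← Matrix.exp_transpose, hA]
  have hτ : (NormedSpace.exp (-A)).transpose = NormedSpace.exp (-A) := by
    rw [← Matrix.exp_transpose, Matrix.transpose_neg, hA]
  have hcomm : A * NormedSpace.exp A = NormedSpace.exp A * A := by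
    let := Matrix.linftyOpNormedRing (n := Fin d) (α := ℝ)
    let := Matrix.linftyOpNormedAlgebra (n := Fin d) (R := ℝ) (α := ℝ)
    exact ((Commute.refl A).exp_right).eq
  have hinv := exp_neg_mul_exp A
  have hinv' : NormedSpace.exp (-A) * NormedSpace.exp A = 1 := by
    simpa using exp_neg_mul_exp (-A)
  have heq := h.eq
  rw [← Matrix.exp_neg] at heq
  set σ := NormedSpace.exp A
  set τ := NormedSpace.exp (-A)
  have hN0 : N.trace = 0 := by
    simpa using trace_mul_eq_zero_of_symm_antisymm (S := 1) Matrix.transpose_one h.antisymm_N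
  have hΩ0 : Ω.trace = 0 := by
    simpa using trace_mul_eq_zero_of_symm_antisymm (S := 1) Matrix.transpose_one h.antisymm_Ω
  have hσΩ : (σ * Ω).trace = 0 := trace_mul_eq_zero_of_symm_antisymm hσ h.antisymm_Ω
  have hNτ : (N * τ).trace = 0 := by
    rw [Matrix.trace_mul_comm]
    exact trace_mul_eq_zero_of_symm_antisymm hτ h.antisymm_N
  -- Incompressibility enters here: Ω and N e^{-A} are traceless, so tr B = tr G.
  have hB0 : B.trace = 0 := by
    have := hG
    rw [heq, Matrix.trace_add, Matrix.trace_add, hΩ0, hNτ] at this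
    linarith
  -- Against σ only B is visible: Ω is antisymmetric and σ symmetric, while in tr(σNτ) the factors σ
  -- and τ cancel cyclically and leave tr N = 0.
  have hσG : (σ * G).trace = (σ * B).trace := by
    rw [heq, mul_add, mul_add, Matrix.trace_add, Matrix.trace_add, hσΩ,
      Matrix.trace_mul_comm σ (N * τ), mul_assoc, hinv', mul_one, hN0]
    ring
  -- Since A commutes with σ, the commutator ΩA - AΩ has zero trace against σ.
  have h1 : (σ * (Ω * A)).trace = (σ * (A * Ω)).trace := by
    rw [Matrix.trace_mul_comm, mul_assoc, hcomm, Matrix.trace_mul_comm, mul_assoc]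
  have h2 : (Ω * A).trace = (A * Ω).trace := Matrix.trace_mul_comm _ _
  simp only [sub_mul, mul_add, mul_sub, one_mul, Matrix.mul_smul, Matrix.trace_add,
    Matrix.trace_sub, Matrix.trace_smul, mul_one, hinv, h1, h2, hσG, hB0, smul_eq_mul]
  ring

end LogOldroydB

end MatrixAlgebra

/-! ### The same functions, on arrays of entries. -/

section MatrixFunctions

attribute [local instance] Matrix.linftyOpNormedRing Matrix.linftyOpNormedAlgebra

namespace LogOldroydB

variable {d : ℕ}

/-- An array of real numbers, regarded as a matrix. -/
noncomputable def ofCLM (d : ℕ) : (Fin d → Fin d → ℝ) →L[ℝ] Matrix (Fin d) (Fin d) ℝ :=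
  ((Matrix.ofLinearEquiv ℝ).toLinearMap : (Fin d → Fin d → ℝ) →ₗ[ℝ] _).toContinuousLinearMap

/-- The function `A ↦ tr(e^A - A - I)` of the entries of `A`. -/
noncomputable def entropyFun (v : Fin d → Fin d → ℝ) : ℝ :=
  (NormedSpace.exp (Matrix.of v) - Matrix.of v - 1).trace

/-- The function `A ↦ (e^A)_{ij}` of the entries of `A`. -/
noncomputable def expEntry (i j : Fin d) (v : Fin d → Fin d → ℝ) : ℝ :=
  NormedSpace.exp (Matrix.of v) i j

/-- The function `A ↦ tr(e^A + e^{-A} - 2I)` of the entries of `A`. -/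
noncomputable def dissipationFun (v : Fin d → Fin d → ℝ) : ℝ :=
  (NormedSpace.exp (Matrix.of v) + NormedSpace.exp (-Matrix.of v) -
    (2 : ℝ) • (1 : Matrix (Fin d) (Fin d) ℝ)).trace

theorem contDiff_entropyFun {n : WithTop ℕ∞} :
    ContDiff ℝ n (entropyFun : (Fin d → Fin d → ℝ) → ℝ) :=
  contDiff_trace_exp_sub.comp (ofCLM d).contDiff

theorem contDiff_expEntry {n : WithTop ℕ∞} (i j : Fin d) : ContDiff ℝ n (expEntry i j) :=
  (contDiff_exp_entry i j).comp (ofCLM d).contDiff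

theorem continuous_dissipationFun :
    Continuous (dissipationFun : (Fin d → Fin d → ℝ) → ℝ) := by
  have h : Continuous (fun X : Matrix (Fin d) (Fin d) ℝ => NormedSpace.exp X) :=
    (contDiff_matrix_exp (n := 0)).continuous
  exact (traceCLM d).continuous.comp
    (((h.comp (ofCLM d).continuous).add (h.comp (ofCLM d).continuous.neg)).sub continuous_const)

theorem fderiv_entropyFun (v h : Fin d → Fin d → ℝ) :
    fderiv ℝ entropyFun v h =
      ((NormedSpace.exp (Matrix.of v) - 1) * Matrix.of h).trace := by
  have h1 : HasFDerivAt
      (fun X : Matrix (Fin d) (Fin d) ℝ => (NormedSpace.exp X - X - 1).trace)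
      (fderiv ℝ (fun X : Matrix (Fin d) (Fin d) ℝ => (NormedSpace.exp X - X - 1).trace)
        (ofCLM d v)) (ofCLM d v) :=
    ((contDiff_trace_exp_sub (n := 1)).differentiable (by simp) _).hasFDerivAt
  have h2 : HasFDerivAt (entropyFun : (Fin d → Fin d → ℝ) → ℝ) _ v :=
    h1.comp v (ofCLM d).hasFDerivAt
  rw [h2.fderiv]
  exact fderiv_trace_exp_sub _ _

end LogOldroydB

end MatrixFunctions

/-! ### Calculus for functions of C¹ matrix fields, in space and in time. -/

section Fields

namespace LogOldroydB

variable {d : ℕ} {D : Opens (EuclideanSpace ℝ (Fin d))}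

/-- The array of values at `x` of a field with entries in `C¹(D)`. -/
def fieldVal (ψ : Fin d → Fin d → C1 D) (x : D) : Fin d → Fin d → ℝ := fun i j => (ψ i j).fn x

/-- The array of partial derivatives at `x` of a field with entries in `C¹(D)`. -/
def fieldPartial (ψ : Fin d → Fin d → C1 D) (k : Fin d) (x : D) : Fin d → Fin d → ℝ :=
  fun i j => (ψ i j).grad k x

theorem continuous_fieldVal (ψ : Fin d → Fin d → C1 D) : Continuous (fieldVal ψ) :=
  continuous_pi fun i => continuous_pi fun j => (ψ i j).1.1.continuous

theorem continuous_fieldPartial (ψ : Fin d → Fin d → C1 D) (k : Fin d) :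
    Continuous (fieldPartial ψ k) :=
  continuous_pi fun i => continuous_pi fun j => ((ψ i j).1.2 k).continuous

theorem norm_fieldVal_le (ψ : Fin d → Fin d → C1 D) (x : D) : ‖fieldVal ψ x‖ ≤ ‖ψ‖ := by
  refine (pi_norm_le_iff_of_nonneg (norm_nonneg _)).2 fun i =>
    (pi_norm_le_iff_of_nonneg (norm_nonneg _)).2 fun j => ?_
  calc ‖(ψ i j).1.1 x‖ ≤ ‖(ψ i j).1.1‖ := (ψ i j).1.1.norm_coe_le_norm x
    _ ≤ ‖(ψ i j).1‖ := norm_fst_le _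
    _ ≤ ‖ψ i‖ := norm_le_pi_norm (ψ i) j
    _ ≤ ‖ψ‖ := norm_le_pi_norm ψ i

theorem norm_fieldPartial_le (ψ : Fin d → Fin d → C1 D) (k : Fin d) (x : D) :
    ‖fieldPartial ψ k x‖ ≤ ‖ψ‖ := by
  refine (pi_norm_le_iff_of_nonneg (norm_nonneg _)).2 fun i =>
    (pi_norm_le_iff_of_nonneg (norm_nonneg _)).2 fun j => ?_
  calc ‖(ψ i j).1.2 k x‖ ≤ ‖(ψ i j).1.2 k‖ := ((ψ i j).1.2 k).norm_coe_le_norm x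
    _ ≤ ‖(ψ i j).1.2‖ := norm_le_pi_norm _ k
    _ ≤ ‖(ψ i j).1‖ := norm_snd_le _
    _ ≤ ‖ψ i‖ := norm_le_pi_norm (ψ i) j
    _ ≤ ‖ψ‖ := norm_le_pi_norm ψ i

/-- Evaluation at `x` as a continuous linear map. -/
noncomputable def fieldEval (x : D) : (Fin d → Fin d → C1 D) →L[ℝ] (Fin d → Fin d → ℝ) :=
  LinearMap.mkContinuous
    { toFun := fun ψ => fieldVal ψ x
      map_add' := fun _ _ => rfl
      map_smul' := fun _ _ => rfl } 1 fun ψ => by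
    rw [one_mul]
    exact norm_fieldVal_le ψ x

/-- A continuous function of a bounded continuous field is bounded. -/
theorem exists_bound_comp {X V : Type*} [NormedAddCommGroup V] [ProperSpace V] {v : X → V}
    {R : ℝ} (hR : ∀ x, ‖v x‖ ≤ R) {g : V → ℝ} (hg : Continuous g) :
    ∃ C, ∀ x, ‖g (v x)‖ ≤ C := by
  obtain ⟨C, hC⟩ := (isCompact_closedBall (0 : V) R).exists_bound_of_continuousOn hg.continuousOn
  exact ⟨C, fun x => hC _ (by simpa using hR x)⟩

theorem memLp_of_continuous_of_bound [IsFiniteMeasure (volume : Measure D)] {f : D → ℝ}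
    (hf : Continuous f) {C : ℝ} (hC : ∀ x, ‖f x‖ ≤ C) {p : ℝ≥0∞} : MemLp f p volume :=
  MemLp.of_bound hf.aestronglyMeasurable C (Filter.Eventually.of_forall hC)

theorem memLp_comp_fieldVal [IsFiniteMeasure (volume : Measure D)]
    (ψ : Fin d → Fin d → C1 D) {g : (Fin d → Fin d → ℝ) → ℝ} (hg : Continuous g) {p : ℝ≥0∞} :
    MemLp (fun x : D => g (fieldVal ψ x)) p volume := by
  obtain ⟨C, hC⟩ := exists_bound_comp (norm_fieldVal_le ψ) hg
  exact memLp_of_continuous_of_bound (hg.comp (continuous_fieldVal ψ)) hC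

theorem continuous_fderiv_comp_fieldVal (ψ : Fin d → Fin d → C1 D)
    {g : (Fin d → Fin d → ℝ) → ℝ} (hg : ContDiff ℝ 1 g) {h : D → Fin d → Fin d → ℝ}
    (hh : Continuous h) : Continuous fun x : D => fderiv ℝ g (fieldVal ψ x) (h x) :=
  ((hg.continuous_fderiv (by simp)).comp (continuous_fieldVal ψ)).clm_apply hh

theorem exists_bound_fderiv_comp_fieldVal (ψ : Fin d → Fin d → C1 D)
    {g : (Fin d → Fin d → ℝ) → ℝ} (hg : ContDiff ℝ 1 g) {h : D → Fin d → Fin d → ℝ} {R : ℝ}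
    (hh : ∀ x, ‖h x‖ ≤ R) : ∃ C, ∀ x : D, ‖fderiv ℝ g (fieldVal ψ x) (h x)‖ ≤ C := by
  have hc : Continuous fun q : (Fin d → Fin d → ℝ) × (Fin d → Fin d → ℝ) =>
      fderiv ℝ g q.1 q.2 :=
    ((hg.continuous_fderiv (by simp)).comp continuous_fst).clm_apply continuous_snd
  exact exists_bound_comp (v := fun x : D => (fieldVal ψ x, h x)) (R := max ‖ψ‖ R)
    (fun x => max_le_max (norm_fieldVal_le ψ x) (hh x)) hc

theorem memLp_fderiv_comp_fieldVal [IsFiniteMeasure (volume : Measure D)]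
    (ψ : Fin d → Fin d → C1 D) {g : (Fin d → Fin d → ℝ) → ℝ} (hg : ContDiff ℝ 1 g)
    {h : D → Fin d → Fin d → ℝ} (hc : Continuous h) {R : ℝ} (hR : ∀ x, ‖h x‖ ≤ R)
    {p : ℝ≥0∞} : MemLp (fun x : D => fderiv ℝ g (fieldVal ψ x) (h x)) p volume := by
  obtain ⟨C, hC⟩ := exists_bound_fderiv_comp_fieldVal ψ hg hR
  exact memLp_of_continuous_of_bound (continuous_fderiv_comp_fieldVal ψ hg hc) hC

theorem extendZero_coe (f : D → ℝ) (x : D) : extendZero f x = f x :=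
  Subtype.val_injective.extend_apply f 0 x

/-- The chain rule for a function of a `C¹` field. -/
theorem hasFDerivAt_extendZero_comp (ψ : Fin d → Fin d → C1 D)
    {g : (Fin d → Fin d → ℝ) → ℝ} (hg : ContDiff ℝ 1 g) (x : D) :
    HasFDerivAt (extendZero fun y : D => g (fieldVal ψ y))
      ((fderiv ℝ g (fieldVal ψ x)).comp (ContinuousLinearMap.pi fun i =>
        ContinuousLinearMap.pi fun j => gradForm fun k => (ψ i j).grad k x))
      (x : EuclideanSpace ℝ (Fin d)) := by
  have h1 : HasFDerivAt (fun y i j => extendZero (ψ i j).1.1 y)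
      (ContinuousLinearMap.pi fun i =>
        ContinuousLinearMap.pi fun j => gradForm fun k => (ψ i j).grad k x)
      (x : EuclideanSpace ℝ (Fin d)) :=
    hasFDerivAt_pi.2 fun i => hasFDerivAt_pi.2 fun j => (ψ i j).2 x
  have hx : (fun i j => extendZero (ψ i j).1.1 (x : EuclideanSpace ℝ (Fin d))) =
      fieldVal ψ x := by
    funext i j
    exact extendZero_coe _ x
  have h2 : HasFDerivAt g (fderiv ℝ g (fieldVal ψ x))
      (fun i j => extendZero (ψ i j).1.1 (x : EuclideanSpace ℝ (Fin d))) := by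
    rw [hx]
    exact (hg.differentiable (by simp) _).hasFDerivAt
  -- Off D the zero extension of g ∘ ψ and g of the zero extension of ψ differ when g 0 ≠ 0, so the
  -- two are compared only near x.
  refine (h2.comp (x : EuclideanSpace ℝ (Fin d)) h1).congr_of_eventuallyEq ?_
  filter_upwards [D.isOpen.mem_nhds x.2] with y hy
  obtain ⟨z, rfl⟩ : ∃ z : D, (z : EuclideanSpace ℝ (Fin d)) = y := ⟨⟨y, hy⟩, rfl⟩
  rw [extendZero_coe]
  refine congrArg g ?_
  funext i j
  exact (extendZero_coe _ z).symm

theorem gradForm_basisVec (v : Fin d → ℝ) (k : Fin d) : gradForm v (basisVec k) = v k := by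
  simp [gradForm, basisVec, sum_apply]

theorem fderiv_extendZero_comp (ψ : Fin d → Fin d → C1 D)
    {g : (Fin d → Fin d → ℝ) → ℝ} (hg : ContDiff ℝ 1 g) (x : D) (k : Fin d) :
    fderiv ℝ (extendZero fun y : D => g (fieldVal ψ y)) (x : EuclideanSpace ℝ (Fin d))
      (basisVec k) = fderiv ℝ g (fieldVal ψ x) (fieldPartial ψ k x) := by
  rw [(hasFDerivAt_extendZero_comp ψ hg x).fderiv, ContinuousLinearMap.comp_apply]
  congr 1
  funext i j
  exact gradForm_basisVec _ k

/-- A function of a `C¹` field is weakly differentiable. -/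
theorem integral_comp_mul_partialTest [IsFiniteMeasure (volume : Measure D)]
    (ψ : Fin d → Fin d → C1 D) {g : (Fin d → Fin d → ℝ) → ℝ} (hg : ContDiff ℝ 1 g) (k : Fin d)
    (φ : TestFunction D ℝ ⊤) :
    ∫ x : D, g (fieldVal ψ x) * partialTest φ k x =
      -∫ x : D, fderiv ℝ g (fieldVal ψ x) (fieldPartial ψ k x) * φ x := by
  refine integral_mul_partialTest_of_hasLineDerivAt k (memLp_comp_fieldVal ψ hg.continuous)
    (memLp_fderiv_comp_fieldVal ψ hg (continuous_fieldPartial ψ k) (norm_fieldPartial_le ψ k))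
    (fun x => ?_) φ
  rw [← fderiv_extendZero_comp ψ hg x k]
  exact (hasFDerivAt_extendZero_comp ψ hg x).differentiableAt.hasFDerivAt.hasLineDerivAt _

/-- Differentiation under the integral sign for a function of a time-dependent `C¹` field. -/
theorem hasDerivWithinAt_integral_comp [IsFiniteMeasure (volume : Measure D)]
    {ψ : ℝ → Fin d → Fin d → C1 D} {ψ' : Fin d → Fin d → C1 D} {S : Set ℝ} {t : ℝ}
    (hψ : HasDerivWithinAt ψ ψ' S t) {g : (Fin d → Fin d → ℝ) → ℝ} (hg : ContDiff ℝ 1 g) :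
    HasDerivWithinAt (fun s => ∫ x : D, g (fieldVal (ψ s) x))
      (∫ x : D, fderiv ℝ g (fieldVal (ψ t) x) (fieldVal ψ' x)) S t := by
  have hpt : ∀ x : D, HasDerivWithinAt (fun s => g (fieldVal (ψ s) x))
      (fderiv ℝ g (fieldVal (ψ t) x) (fieldVal ψ' x)) S t := fun x =>
    ((hg.differentiable (by simp) (fieldVal (ψ t) x)).hasFDerivAt).comp_hasDerivWithinAt t
      ((fieldEval x).hasFDerivAt.comp_hasDerivWithinAt t hψ)
  have hint : ∀ s, Integrable (fun x : D => g (fieldVal (ψ s) x)) := fun s =>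
    memLp_one_iff_integrable.1 (memLp_comp_fieldVal (ψ s) hg.continuous)
  -- For s near t all values of `ψ s` lie in the ball of radius R, where g is Lipschitz with
  -- constant K. This bounds the difference quotients by a constant, which is integrable because D
  -- has finite measure.
  set R := ‖ψ t‖ + 1
  obtain ⟨K, hK⟩ := (isCompact_closedBall (0 : Fin d → Fin d → ℝ) R).exists_bound_of_continuousOn
    (hg.continuous_fderiv (by simp)).continuousOn
  have hlip : ∀ v w : Fin d → Fin d → ℝ, ‖v‖ ≤ R → ‖w‖ ≤ R → ‖g w - g v‖ ≤ K * ‖w - v‖ :=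
    fun v w hv hw => (convex_closedBall (0 : Fin d → Fin d → ℝ)
      R).norm_image_sub_le_of_norm_fderiv_le
      (fun z _ => hg.differentiable (by simp) z) hK (by simpa using hv) (by simpa using hw)
  have hK0 : 0 ≤ K := (norm_nonneg _).trans (hK 0 (by simp [R]; positivity))
  rw [hasDerivWithinAt_iff_tendsto_slope] at hψ ⊢
  have hslope : slope (fun s => ∫ x : D, g (fieldVal (ψ s) x)) t =
      fun s => ∫ x : D, slope (fun s => g (fieldVal (ψ s) x)) t s := by
    funext s
    simp only [slope_def_field]
    rw [integral_div, integral_sub (hint s) (hint t)]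
  rw [hslope]
  have hcont : Filter.Tendsto ψ (nhdsWithin t (S \ {t})) (nhds (ψ t)) := by
    have := (hasDerivWithinAt_iff_tendsto_slope.2 hψ).continuousWithinAt
    exact this.mono_left (nhdsWithin_mono _ Set.sdiff_subset)
  refine tendsto_integral_filter_of_dominated_convergence (fun _ => K * (‖ψ'‖ + 1)) ?_ ?_
    (integrable_const _) ?_
  · refine Filter.Eventually.of_forall fun s => ?_
    simp only [slope_def_field]
    exact (((hint s).sub (hint t)).div_const _).aestronglyMeasurable
  · filter_upwards [hcont.norm.eventually_le_const (show ‖ψ t‖ < R by simp [R]),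
      hψ.norm.eventually_le_const (show ‖ψ'‖ < ‖ψ'‖ + 1 by simp)] with s hs hs'
    refine Filter.Eventually.of_forall fun x => ?_
    have h1 := hlip _ _ ((norm_fieldVal_le (ψ t) x).trans (by simp [R]))
      ((norm_fieldVal_le (ψ s) x).trans hs)
    have h2 : ‖fieldVal (ψ s) x - fieldVal (ψ t) x‖ ≤ ‖ψ s - ψ t‖ :=
      norm_fieldVal_le (ψ s - ψ t) x
    rw [slope_def_module, norm_smul] at hs' ⊢
    calc ‖(s - t)⁻¹‖ * ‖g (fieldVal (ψ s) x) - g (fieldVal (ψ t) x)‖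
        ≤ ‖(s - t)⁻¹‖ * (K * ‖ψ s - ψ t‖) := by
          gcongr
          exact h1.trans (by gcongr)
      _ = K * (‖(s - t)⁻¹‖ * ‖ψ s - ψ t‖) := by ring
      _ ≤ K * (‖ψ'‖ + 1) := by gcongr
  · exact Filter.Eventually.of_forall fun x => hasDerivWithinAt_iff_tendsto_slope.1 (hpt x)

/-- The inclusion of `H²(D)` in `L²(D)` as a continuous linear map. -/
noncomputable def H2.fnL (D : Opens (EuclideanSpace ℝ (Fin d))) : H2 D →L[ℝ] L2 D :=
  (ContinuousLinearMap.fst ℝ (L2 D) (Fin d → L2 D)).comp ((H1Sub D).subtypeL.comp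
    ((ContinuousLinearMap.fst ℝ (H1 D) (Fin d → H1 D)).comp (H2Sub D).subtypeL))

theorem hasDerivWithinAt_integral_sq {u : ℝ → H2 D} {u' : H2 D} {S : Set ℝ} {t : ℝ}
    (hu : HasDerivWithinAt u u' S t) :
    HasDerivWithinAt (fun s => ∫ x : D, (u s).fn x ^ 2) (2 * ∫ x : D, u'.fn x * (u t).fn x)
      S t := by
  have h := ((H2.fnL D).hasFDerivAt.comp_hasDerivWithinAt t hu).norm_sq
  simp only [integral_sq_eq_norm, ← inner_L2_eq]
  rw [real_inner_comm]
  exact h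

end LogOldroydB

end Fields

/-! ### The two equations tested with their multipliers. -/

section EnergyIdentities

namespace LogOldroydB

variable {d : ℕ} {D : Opens (EuclideanSpace ℝ (Fin d))}

theorem integrable_mul_L2 {f : D → ℝ} (hf : MemLp f 2) (g : L2 D) :
    Integrable (fun x : D => f x * g x) :=
  hf.integrable_mul (Lp.memLp g)

theorem memLp_mul_test (f : L2 D) (φ : TestFunction D ℝ ⊤) :
    MemLp (fun x : D => f x * φ x) 2 :=
  (memLp_test φ (p := ∞)).mul (Lp.memLp f)

theorem memLp_mul_partialTest (f : L2 D) (φ : TestFunction D ℝ ⊤) (i : Fin d) :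
    MemLp (fun x : D => f x * partialTest φ i x) 2 :=
  (memLp_partialTest φ i (p := ∞)).mul (Lp.memLp f)

theorem memLp_mul_of_memLp_four {f g : D → ℝ} (hf : MemLp f 4) (hg : MemLp g 4) :
    MemLp (fun x : D => f x * g x) 2 := by
  have : ENNReal.HolderTriple 4 4 2 := ⟨by
    rw [show (4 : ℝ≥0∞) = 2 * 2 by norm_num, ENNReal.mul_inv (by simp) (by simp), ← two_mul,
      ← mul_assoc, ENNReal.mul_inv_cancel (by simp) (by simp), one_mul]⟩
  exact hg.mul hf

/-- A divergence free field `b ∈ H¹(D)^d` is weakly skew-symmetric between test functions and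
`H¹₀(D)`. -/
theorem sum_integral_mul_partialTest_of_divergence_free {b : Fin d → H1 D}
    (hdiv : ∀ᵐ x : D, ∑ i, (b i).grad i x = 0) {v : H1 D} (hv : v ∈ H10 D)
    (φ : TestFunction D ℝ ⊤) :
    ∑ j, ∫ x : D, (b j).fn x * φ x * v.grad j x =
      -∫ x : D, (∑ j, (b j).fn x * partialTest φ j x) * v.fn x := by
  refine H10.integral_eq (F := fun j x => (b j).fn x * φ x)
    (h := fun x => ∑ j, (b j).fn x * partialTest φ j x)
    (fun j => memLp_mul_test _ _) (memLp_finsetSum _ fun j _ => memLp_mul_partialTest _ _ _)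
    (fun χ => ?_) hv
  -- The weak derivative of b_j is tested against the product φχ; the right sides sum to zero over j
  -- because div b = 0.
  have hw : ∀ j, ∫ x : D, (b j).fn x * φ x * partialTest χ j x +
      (b j).fn x * partialTest φ j x * χ x = -∫ x : D, (b j).grad j x * (φ x * χ x) := fun j => by
    have h : ∫ x : D, (b j).fn x * partialTest (testMul φ χ) j x =
        -∫ x : D, (b j).grad j x * testMul φ χ x := (b j).2 j (testMul φ χ)
    rw [show (fun x : D => (b j).grad j x * (φ x * χ x)) =
      fun x : D => (b j).grad j x * testMul φ χ x from rfl, ← h]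
    refine integral_congr_ae (Filter.Eventually.of_forall fun x => ?_)
    simp only [partialTest_testMul]
    ring
  have hi1 : ∀ j, Integrable (fun x : D => (b j).fn x * φ x * partialTest χ j x) := fun j =>
    (memLp_mul_test (b j).fn φ).integrable_mul (memLp_partialTest χ j (p := 2))
  have hi2 : ∀ j, Integrable (fun x : D => (b j).fn x * partialTest φ j x * χ x) := fun j =>
    (memLp_mul_partialTest (b j).fn φ j).integrable_mul (memLp_test χ (p := 2))
  have hi3 : ∀ j, Integrable (fun x : D => (b j).grad j x * (φ x * χ x)) := fun j =>
    integrable_mul_test ((b j).grad j) (testMul φ χ)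
  have hsum : ∑ j, ∫ x : D, (b j).grad j x * (φ x * χ x) = 0 := by
    rw [← integral_finsetSum _ fun j _ => hi3 j]
    refine integral_eq_zero_of_ae ?_
    filter_upwards [hdiv] with x hx
    rw [← Finset.sum_mul, hx, zero_mul, Pi.zero_apply]
  have h2 : ∫ x : D, (∑ j, (b j).fn x * partialTest φ j x) * χ x =
      ∑ j, ∫ x : D, (b j).fn x * partialTest φ j x * χ x := by
    rw [← integral_finsetSum _ fun j _ => hi2 j]
    simp only [Finset.sum_mul]
  rw [h2, eq_neg_iff_add_eq_zero, ← Finset.sum_add_distrib, ← neg_zero, ← hsum,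
    ← Finset.sum_neg_distrib]
  refine Finset.sum_congr rfl fun j _ => ?_
  rw [← hw j, integral_add (hi1 j) (hi2 j)]

/-- The convective term does not contribute to the energy balance. -/
theorem integral_convective_eq_zero (hd : d = 2 ∨ d = 3)
    (hD : Bornology.IsBounded (D : Set (EuclideanSpace ℝ (Fin d)))) {b : Fin d → H1 D}
    (hb : ∀ i, b i ∈ H10 D) (hdiv : ∀ᵐ x : D, ∑ i, (b i).grad i x = 0) {v : H1 D}
    (hv : v ∈ H10 D) (hm : MemLp (fun x : D => ∑ j, (b j).fn x * v.grad j x) 2) :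
    ∫ x : D, (∑ j, (b j).fn x * v.grad j x) * v.fn x = 0 := by
  have h4 : ∀ j, MemLp (fun x : D => (b j).fn x * v.fn x) 2 := fun j =>
    memLp_mul_of_memLp_four (H10.memLp_four hd hD (hb j)) (H10.memLp_four hd hD hv)
  -- The field vb is in L² by the L⁴ bounds, and its weak divergence is b · ∇v. Testing it with v
  -- itself shows that the integral equals its own negative.
  have key := H10.integral_eq (F := fun j x => (b j).fn x * v.fn x)
    (h := fun x => ∑ j, (b j).fn x * v.grad j x) h4 hm (fun φ => ?_) hv
  · have e : ∑ j, ∫ x : D, (b j).fn x * v.fn x * v.grad j x =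
        ∫ x : D, (∑ j, (b j).fn x * v.grad j x) * v.fn x := by
      rw [← integral_finsetSum _ fun j _ => integrable_mul_L2 (h4 j) (v.grad j)]
      refine integral_congr_ae (Filter.Eventually.of_forall fun x => ?_)
      simp only [Finset.sum_mul]
      exact Finset.sum_congr rfl fun j _ => by ring
    rw [e] at key
    linarith
  · have h := sum_integral_mul_partialTest_of_divergence_free hdiv hv φ
    have e1 : ∑ j, ∫ x : D, (b j).fn x * φ x * v.grad j x =
        ∫ x : D, (∑ j, (b j).fn x * v.grad j x) * φ x := by
      rw [← integral_finsetSum _ fun j _ =>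
        integrable_mul_L2 (memLp_mul_test (b j).fn φ) (v.grad j)]
      refine integral_congr_ae (Filter.Eventually.of_forall fun x => ?_)
      simp only [Finset.sum_mul]
      exact Finset.sum_congr rfl fun j _ => by ring
    have e2 : ∑ j, ∫ x : D, (b j).fn x * v.fn x * partialTest φ j x =
        ∫ x : D, (∑ j, (b j).fn x * partialTest φ j x) * v.fn x := by
      have hi : ∀ j, Integrable (fun x : D => (b j).fn x * v.fn x * partialTest φ j x) :=
        fun j => (h4 j).integrable_mul (memLp_partialTest φ j (p := 2))
      rw [← integral_finsetSum _ fun j _ => hi j]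
      refine integral_congr_ae (Filter.Eventually.of_forall fun x => ?_)
      simp only [Finset.sum_mul]
      exact Finset.sum_congr rfl fun j _ => by ring
    rw [e2, ← e1, h, neg_neg]

/-- A gradient is orthogonal to divergence free fields in `H¹₀(D)^d`. -/
theorem sum_integral_partial_mul_eq_zero {b : Fin d → H1 D} (hb : ∀ i, b i ∈ H10 D)
    (hdiv : ∀ᵐ x : D, ∑ i, (b i).grad i x = 0) {f : D → ℝ} {f' : Fin d → D → ℝ}
    (hf : MemLp f 2) (hf' : ∀ i, MemLp (f' i) 2)
    (h : ∀ i (φ : TestFunction D ℝ ⊤),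
      ∫ x : D, f x * partialTest φ i x = -∫ x : D, f' i x * φ x) :
    ∑ i, ∫ x : D, f' i x * (b i).fn x = 0 := by
  have h1 : ∀ i, ∫ x : D, f' i x * (b i).fn x = -∫ x : D, f x * (b i).grad i x := fun i => by
    rw [H10.integral_mul_grad i hf (hf' i) (h i) (hb i), neg_neg]
  simp only [h1, Finset.sum_neg_distrib, neg_eq_zero]
  rw [← integral_finsetSum _ fun i _ => integrable_mul_L2 hf ((b i).grad i)]
  refine integral_eq_zero_of_ae ?_
  filter_upwards [hdiv] with x hx
  rw [← Finset.mul_sum, hx, mul_zero, Pi.zero_apply]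

theorem integral_hess_mul {w : H2 D} (hw : w.toH1 ∈ H10 D) (j : Fin d) :
    ∫ x : D, w.hess j j x * w.fn x = -∫ x : D, w.grad j x ^ 2 := by
  have h := H10.integral_mul_grad (f := w.grad j) (f' := w.hess j j) j (Lp.memLp _) (Lp.memLp _)
    (fun φ => ?_) hw
  · simp only [sq]
    exact neg_eq_iff_eq_neg.1 h.symm
  · have : w.grad j = (w.1.2 j).fn := (w.2 j).symm
    rw [this]
    exact (w.1.2 j).2 j φ

theorem divExp_eq (ψ : Fin d → Fin d → C1 D) (i : Fin d) :
    divExp ψ i =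
      fun x => ∑ j, fderiv ℝ (expEntry i j) (fieldVal ψ x) (fieldPartial ψ j x) := by
  funext x
  exact Finset.sum_congr rfl fun j _ => fderiv_extendZero_comp ψ (contDiff_expEntry i j) x j

theorem memLp_fderiv_expEntry [IsFiniteMeasure (volume : Measure D)]
    (ψ : Fin d → Fin d → C1 D) (i j k : Fin d) :
    MemLp (fun x : D => fderiv ℝ (expEntry i j) (fieldVal ψ x) (fieldPartial ψ k x)) 2 :=
  memLp_fderiv_comp_fieldVal ψ (contDiff_expEntry i j) (continuous_fieldPartial ψ k)
    (norm_fieldPartial_le ψ k)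

theorem memLp_divExp [IsFiniteMeasure (volume : Measure D)] (ψ : Fin d → Fin d → C1 D)
    (i : Fin d) : MemLp (divExp ψ i) 2 := by
  rw [divExp_eq]
  exact memLp_finsetSum _ fun j _ => memLp_fderiv_expEntry ψ i j j

theorem memLp_expMat [IsFiniteMeasure (volume : Measure D)] (ψ : Fin d → Fin d → C1 D)
    (i j : Fin d) : MemLp (fun x : D => expMat ψ x i j) 2 :=
  memLp_comp_fieldVal ψ (contDiff_expEntry (n := 0) i j).continuous

theorem integral_divExp_mul [IsFiniteMeasure (volume : Measure D)] (ψ : Fin d → Fin d → C1 D)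
    (i : Fin d) {w : H1 D} (hw : w ∈ H10 D) :
    ∫ x : D, divExp ψ i x * w.fn x = -∑ j, ∫ x : D, expMat ψ x i j * w.grad j x := by
  have h : ∀ j, ∫ x : D, expMat ψ x i j * w.grad j x =
      -∫ x : D, fderiv ℝ (expEntry i j) (fieldVal ψ x) (fieldPartial ψ j x) * w.fn x := fun j =>
    H10.integral_mul_grad j (memLp_expMat ψ i j) (memLp_fderiv_expEntry ψ i j j)
      (integral_comp_mul_partialTest ψ (contDiff_expEntry i j) j) hw
  simp only [h, Finset.sum_neg_distrib, neg_neg, divExp_eq, Finset.sum_mul]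
  exact integral_finsetSum _ fun j _ => integrable_mul_L2 (memLp_fderiv_expEntry ψ i j j) w.fn

/-- The `i`-th momentum equation tested with `u_i`. -/
theorem integral_momentum [IsFiniteMeasure (volume : Measure D)] {Re a c : ℝ} {u : Fin d → H2 D}
    {i : Fin d} {u' : H2 D} {p : H1 D} {ψ : Fin d → Fin d → C1 D}
    (hu : (u i).toH1 ∈ H10 D)
    (hconv : MemLp (fun x : D => ∑ j, (u j).fn x * (u i).grad j x) 2 →
      ∫ x : D, (∑ j, (u j).fn x * (u i).grad j x) * (u i).fn x = 0)
    (hmom : ∀ᵐ x : D, Re * (u'.fn x + ∑ j, (u j).fn x * (u i).grad j x) =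
      -p.grad i x + a * ∑ j, (u i).hess j j x + c * divExp ψ i x) :
    Re * ∫ x : D, u'.fn x * (u i).fn x =
      -(∫ x : D, p.grad i x * (u i).fn x) - a * (∑ j, ∫ x : D, (u i).grad j x ^ 2) -
        c * ∑ j, ∫ x : D, expMat ψ x i j * (u i).grad j x := by
  -- Without boundary regularity, ∇u in H¹ does not make u · ∇u square integrable. The equation
  -- does: solved for Re times the convective term, it leaves only L² terms. For Re = 0 the term
  -- drops out, so nothing is needed.
  have hm1 : MemLp (fun x : D => -p.grad i x + a * ∑ j, (u i).hess j j x + c * divExp ψ i x -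
      Re * u'.fn x) 2 :=
    (((Lp.memLp (p.grad i)).neg.add ((memLp_finsetSum Finset.univ fun j _ =>
      Lp.memLp ((u i).hess j j)).const_mul a)).add ((memLp_divExp ψ i).const_mul c)).sub
      ((Lp.memLp u'.fn).const_mul Re)
  have hm : MemLp (fun x : D => Re * ∑ j, (u j).fn x * (u i).grad j x) 2 := by
    refine hm1.ae_eq ?_
    filter_upwards [hmom] with x hx
    linarith
  have hc0 : ∫ x : D, (Re * ∑ j, (u j).fn x * (u i).grad j x) * (u i).fn x = 0 := by
    simp only [mul_assoc, integral_const_mul]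
    rcases eq_or_ne Re 0 with h0 | h0
    · rw [h0, zero_mul]
    · rw [hconv ?_, mul_zero]
      simpa [← mul_assoc, inv_mul_cancel₀ h0] using hm.const_mul Re⁻¹
  have e : ∫ x : D, (Re * (u'.fn x * (u i).fn x) +
      (Re * ∑ j, (u j).fn x * (u i).grad j x) * (u i).fn x) =
      ∫ x : D, (-(p.grad i x * (u i).fn x) + a * ∑ j, (u i).hess j j x * (u i).fn x +
        c * (divExp ψ i x * (u i).fn x)) := by
    refine integral_congr_ae ?_
    filter_upwards [hmom] with x hx
    simp only [← Finset.sum_mul]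
    linear_combination (u i).fn x * hx
  have hi : ∀ f : L2 D, Integrable (fun x : D => f x * (u i).fn x) := fun f =>
    integrable_mul_L2 (Lp.memLp f) _
  have hi1 : Integrable (fun x : D => a * ∑ j, (u i).hess j j x * (u i).fn x) :=
    (integrable_finsetSum _ fun j _ => hi ((u i).hess j j)).const_mul a
  have hi2 : Integrable (fun x : D => c * (divExp ψ i x * (u i).fn x)) :=
    (integrable_mul_L2 (memLp_divExp ψ i) _).const_mul c
  have hi3 : Integrable (fun x : D => -(p.grad i x * (u i).fn x)) := (hi _).neg
  rw [integral_add ((hi _).const_mul Re) (integrable_mul_L2 hm _), hc0, add_zero,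
    integral_const_mul, integral_add (by exact hi3.add hi1) hi2, integral_add hi3 hi1, integral_neg,
    integral_const_mul, integral_const_mul,
    integral_finsetSum _ fun j _ => hi ((u i).hess j j),
    show ∫ x : D, divExp ψ i x * (u i).fn x =
      -∑ j, ∫ x : D, expMat ψ x i j * (u i).grad j x from integral_divExp_mul ψ i hu] at e
  rw [e, Finset.sum_congr rfl fun j _ => integral_hess_mul hu j, Finset.sum_neg_distrib]
  ring

theorem expMat_transpose {ψ : Fin d → Fin d → C1 D} {x : D}
    (h : (matVal ψ x).transpose = matVal ψ x) : (expMat ψ x).transpose = expMat ψ x := by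
  rw [expMat, ← Matrix.exp_transpose, h]

theorem trace_gradVel (u : Fin d → H2 D) (x : D) :
    (gradVel u x).trace = ∑ i, (u i).grad i x := rfl

/-- Symmetry of e^ψ matches the trace produced by the constitutive law with the contraction produced
by testing div e^ψ with u, so that the two stress powers can cancel. -/
theorem trace_expMat_mul_gradVel {ψ : Fin d → Fin d → C1 D} {x : D}
    (h : (matVal ψ x).transpose = matVal ψ x) (u : Fin d → H2 D) :
    (expMat ψ x * gradVel u x).trace = ∑ i, ∑ j, expMat ψ x i j * (u i).grad j x := by
  rw [Matrix.trace_mul_comm]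
  simp only [Matrix.trace, Matrix.diag_apply, Matrix.mul_apply]
  refine Finset.sum_congr rfl fun i _ => Finset.sum_congr rfl fun j _ => ?_
  rw [mul_comm, ← Matrix.transpose_apply (expMat ψ x), expMat_transpose h]
  rfl

/-- The constitutive equation tested with `e^ψ - I`, pointwise. -/
theorem entropy_balance_pointwise {c : ℝ} {u : Fin d → H2 D} {ψ ψ' : Fin d → Fin d → C1 D}
    {x : D} (hψ : (matVal ψ x).transpose = matVal ψ x) (hdiv : ∑ i, (u i).grad i x = 0)
    (h : ∃ Ω B N : Matrix (Fin d) (Fin d) ℝ,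
      IsDecomposition (gradVel u x) (expMat ψ x) Ω B N ∧
      matVal ψ' x + ∑ k, (u k).fn x • matPartial ψ k x =
        Ω * matVal ψ x - matVal ψ x * Ω + (2 : ℝ) • B + c • (expNegMat ψ x - 1)) :
    fderiv ℝ entropyFun (fieldVal ψ x) (fieldVal ψ' x) +
        ∑ k, fderiv ℝ entropyFun (fieldVal ψ x) (fieldPartial ψ k x) * (u k).fn x =
      2 * (∑ i, ∑ j, expMat ψ x i j * (u i).grad j x) - c * dissipationDensity ψ x := by
  obtain ⟨Ω, B, N, hdec, heq⟩ := h
  have key := trace_constitutive c hψ ((trace_gradVel u x).trans hdiv) hdec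
  rw [← trace_expMat_mul_gradVel hψ u]
  refine Eq.trans ?_ key
  have h2 := congrArg (fun M => ((expMat ψ x - 1) * M).trace) heq
  refine Eq.trans ?_ h2
  simp only [mul_add, Matrix.mul_sum, Matrix.mul_smul, Matrix.trace_add, Matrix.trace_sum,
    Matrix.trace_smul, fderiv_entropyFun, smul_eq_mul]
  refine congrArg₂ _ rfl (Finset.sum_congr rfl fun k _ => ?_)
  rw [mul_comm]
  rfl

theorem integrable_dissipationDensity [IsFiniteMeasure (volume : Measure D)]
    (ψ : Fin d → Fin d → C1 D) : Integrable (fun x : D => dissipationDensity ψ x) :=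
  memLp_one_iff_integrable.1 (memLp_comp_fieldVal ψ continuous_dissipationFun)

theorem integrable_entropyDensity [IsFiniteMeasure (volume : Measure D)]
    (ψ : Fin d → Fin d → C1 D) : Integrable (fun x : D => entropyDensity ψ x) :=
  memLp_one_iff_integrable.1 (memLp_comp_fieldVal ψ (contDiff_entropyFun (n := 0)).continuous)

/-- The constitutive equation tested with `e^ψ - I`, integrated over `D`. -/
theorem integral_entropy_balance [IsFiniteMeasure (volume : Measure D)] {c : ℝ}
    {u : Fin d → H2 D} {ψ ψ' : Fin d → Fin d → C1 D} (hu : ∀ i, (u i).toH1 ∈ H10 D)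
    (hψ : ∀ x, (matVal ψ x).transpose = matVal ψ x)
    (hdiv : ∀ᵐ x : D, ∑ i, (u i).grad i x = 0)
    (h : ∀ᵐ x : D, ∃ Ω B N : Matrix (Fin d) (Fin d) ℝ,
      IsDecomposition (gradVel u x) (expMat ψ x) Ω B N ∧
      matVal ψ' x + ∑ k, (u k).fn x • matPartial ψ k x =
        Ω * matVal ψ x - matVal ψ x * Ω + (2 : ℝ) • B + c • (expNegMat ψ x - 1)) :
    ∫ x : D, fderiv ℝ entropyFun (fieldVal ψ x) (fieldVal ψ' x) =
      2 * (∑ i, ∑ j, ∫ x : D, expMat ψ x i j * (u i).grad j x) -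
        c * ∫ x : D, dissipationDensity ψ x := by
  have hm : ∀ k, MemLp (fun x : D =>
      fderiv ℝ entropyFun (fieldVal ψ x) (fieldPartial ψ k x)) 2 := fun k =>
    memLp_fderiv_comp_fieldVal ψ contDiff_entropyFun (continuous_fieldPartial ψ k)
      (norm_fieldPartial_le ψ k)
  -- By the chain rule the transport terms are the partial derivatives of the entropy density, so
  -- this is a gradient tested with the divergence free u.
  have htr : ∑ k, ∫ x : D,
      fderiv ℝ entropyFun (fieldVal ψ x) (fieldPartial ψ k x) * (u k).fn x = 0 :=
    sum_integral_partial_mul_eq_zero (b := fun i => (u i).toH1) hu hdiv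
      (f := fun x => entropyFun (fieldVal ψ x))
      (memLp_comp_fieldVal ψ (contDiff_entropyFun (n := 0)).continuous) hm
      (fun k => integral_comp_mul_partialTest ψ contDiff_entropyFun k)
  have hi0 : Integrable (fun x : D => fderiv ℝ entropyFun (fieldVal ψ x) (fieldVal ψ' x)) :=
    memLp_one_iff_integrable.1 (memLp_fderiv_comp_fieldVal ψ contDiff_entropyFun
      (continuous_fieldVal ψ') (norm_fieldVal_le ψ'))
  have hi1 : ∀ k, Integrable (fun x : D =>
      fderiv ℝ entropyFun (fieldVal ψ x) (fieldPartial ψ k x) * (u k).fn x) := fun k =>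
    integrable_mul_L2 (hm k) _
  have hi2 : ∀ i j, Integrable (fun x : D => expMat ψ x i j * (u i).grad j x) := fun i j =>
    integrable_mul_L2 (memLp_expMat ψ i j) _
  have e : ∫ x : D, (fderiv ℝ entropyFun (fieldVal ψ x) (fieldVal ψ' x) +
        ∑ k, fderiv ℝ entropyFun (fieldVal ψ x) (fieldPartial ψ k x) * (u k).fn x) =
      ∫ x : D, (2 * (∑ i, ∑ j, expMat ψ x i j * (u i).grad j x) -
        c * dissipationDensity ψ x) := by
    refine integral_congr_ae ?_
    filter_upwards [hdiv, h] with x hx hx'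
    exact entropy_balance_pointwise (hψ x) hx hx'
  rw [integral_add hi0 (integrable_finsetSum _ fun k _ => hi1 k),
    integral_finsetSum _ fun k _ => hi1 k, htr, add_zero, integral_sub
      ((integrable_finsetSum _ fun i _ => integrable_finsetSum _ fun j _ => hi2 i j).const_mul 2)
      ((integrable_dissipationDensity ψ).const_mul c), integral_const_mul, integral_const_mul,
    integral_finsetSum _ fun i _ => integrable_finsetSum _ fun j _ => hi2 i j] at e
  rw [e]
  congr 2
  exact Finset.sum_congr rfl fun i _ => integral_finsetSum _ fun j _ => hi2 i j

end LogOldroydB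

end EnergyIdentities

/-! ### Energy identity, dissipation bound and exponential decay. -/

section FreeEnergy

namespace LogOldroydB

variable {d : ℕ} {D : Opens (EuclideanSpace ℝ (Fin d))}

theorem freeEnergy_eq (Re Wi ε : ℝ) (u : Fin d → H2 D) (ψ : Fin d → Fin d → C1 D) :
    freeEnergy Re Wi ε u ψ = Re / 2 * (∑ i, ∫ x : D, (u i).fn x ^ 2) +
      ε / (2 * Wi) * ∫ x : D, entropyFun (fieldVal ψ x) := by
  rw [freeEnergy, integral_finsetSum _ fun i _ => integrable_sq (u i).fn]
  rfl

theorem gradEnergy_eq (u : Fin d → H2 D) :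
    gradEnergy u = ∑ i, ∑ j, ∫ x : D, (u i).grad j x ^ 2 := by
  rw [gradEnergy, integral_finsetSum _ fun i _ =>
    integrable_finsetSum _ fun j _ => integrable_sq ((u i).grad j)]
  exact Finset.sum_congr rfl fun i _ => integral_finsetSum _ fun j _ => integrable_sq _

/-- The free energy identity. -/
theorem IsSmoothSolution.hasDerivWithinAt_freeEnergy (hd : d = 2 ∨ d = 3)
    (hD : Bornology.IsBounded (D : Set (EuclideanSpace ℝ (Fin d)))) {Re Wi ε : ℝ} {T : EReal}
    (hWi : 0 < Wi) {u : ℝ → Fin d → H2 D} {p : ℝ → H1 D} {ψ : ℝ → Fin d → Fin d → C1 D}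
    (hsol : IsSmoothSolution D Re Wi ε T u p ψ) {t : ℝ} (ht : t ∈ timeInterval T) :
    HasDerivWithinAt (fun s => freeEnergy Re Wi ε (u s) (ψ s))
      (-((1 - ε) * gradEnergy (u t)) -
        ε / (2 * Wi ^ 2) * ∫ x : D, dissipationDensity (ψ t) x) (timeInterval T) t := by
  have := isFiniteMeasure_of_isBounded hD
  have hu := (hsol.regular_u.differentiableOn (by simp) t ht).hasDerivWithinAt
  have hψ := (hsol.regular_ψ.differentiableOn (by simp) t ht).hasDerivWithinAt
  set u' := derivWithin u (timeInterval T) t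
  set ψ' := derivWithin ψ (timeInterval T) t
  have hdir := hsol.dirichlet t ht
  have hdiv := hsol.incompressible t ht
  have hF : HasDerivWithinAt (fun s => freeEnergy Re Wi ε (u s) (ψ s))
      (Re / 2 * (∑ i, 2 * ∫ x : D, (u' i).fn x * (u t i).fn x) +
        ε / (2 * Wi) * ∫ x : D, fderiv ℝ entropyFun (fieldVal (ψ t) x) (fieldVal ψ' x))
      (timeInterval T) t := by
    simp only [freeEnergy_eq]
    exact ((HasDerivWithinAt.fun_sum fun i _ => hasDerivWithinAt_integral_sq
      (hasDerivWithinAt_pi.1 hu i)).const_mul _).add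
      ((hasDerivWithinAt_integral_comp hψ contDiff_entropyFun).const_mul _)
  convert hF using 1
  have hpress : ∑ i, ∫ x : D, (p t).grad i x * (u t i).fn x = 0 :=
    sum_integral_partial_mul_eq_zero (b := fun i => (u t i).toH1) hdir hdiv
      (Lp.memLp (p t).fn) (fun i => Lp.memLp ((p t).grad i)) (fun i φ => (p t).2 i φ)
  have hmom : ∀ i, Re * ∫ x : D, (u' i).fn x * (u t i).fn x = _ := fun i =>
    integral_momentum (hdir i)
      (integral_convective_eq_zero hd hD (b := fun i => (u t i).toH1) hdir hdiv (hdir i))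
      (hsol.momentum t ht i)
  have hkin : Re / 2 * (∑ i, 2 * ∫ x : D, (u' i).fn x * (u t i).fn x) =
      -((1 - ε) * gradEnergy (u t)) -
        ε / Wi * ∑ i, ∑ j, ∫ x : D, expMat (ψ t) x i j * (u t i).grad j x := by
    rw [← Finset.mul_sum, ← mul_assoc, div_mul_cancel₀ _ two_ne_zero, Finset.mul_sum,
      Finset.sum_congr rfl fun i _ => hmom i, Finset.sum_sub_distrib, Finset.sum_sub_distrib,
      Finset.sum_neg_distrib, hpress, gradEnergy_eq, Finset.mul_sum, Finset.mul_sum]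
    ring
  -- The stress power has factor -ε/Wi in `hkin` and (ε/2Wi) · 2 in the entropy balance, and
  -- cancels.
  rw [hkin, integral_entropy_balance hdir (hsol.symm_ψ t ht) hdiv (hsol.constitutive t ht)]
  field_simp
  ring

theorem entropyDensity_nonneg {ψ : Fin d → Fin d → C1 D} {x : D}
    (h : (matVal ψ x).transpose = matVal ψ x) : 0 ≤ entropyDensity ψ x :=
  trace_exp_sub_sub_one_nonneg h

/-- The difference is tr(e^{-ψ} + ψ - I), the entropy density of -ψ. -/
theorem entropyDensity_le_dissipationDensity {ψ : Fin d → Fin d → C1 D} {x : D}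
    (h : (matVal ψ x).transpose = matVal ψ x) : entropyDensity ψ x ≤ dissipationDensity ψ x := by
  have h1 := trace_exp_sub_sub_one_nonneg (A := -matVal ψ x) (by rw [Matrix.transpose_neg, h])
  simp only [entropyDensity, dissipationDensity, expMat, expNegMat, Matrix.trace_sub,
    Matrix.trace_add, Matrix.trace_smul, Matrix.trace_neg, smul_eq_mul] at h1 ⊢
  linarith

theorem freeEnergy_nonneg {Re Wi ε : ℝ} (hRe : 0 ≤ Re) (hWi : 0 < Wi) (hε : 0 < ε)
    {u : Fin d → H2 D} {ψ : Fin d → Fin d → C1 D}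
    (hψ : ∀ x, (matVal ψ x).transpose = matVal ψ x) : 0 ≤ freeEnergy Re Wi ε u ψ :=
  add_nonneg
    (mul_nonneg (by positivity)
      (integral_nonneg fun _ => Finset.sum_nonneg fun _ _ => sq_nonneg _))
    (mul_nonneg (by positivity) (integral_nonneg fun x => entropyDensity_nonneg (hψ x)))

theorem decayRate_pos {C Re Wi ε : ℝ} (hC : 0 < C) (hRe : 0 ≤ Re) (hWi : 0 < Wi) (hε : ε < 1) :
    0 < decayRate C Re Wi ε := by
  unfold decayRate
  split_ifs with h
  · positivity
  · have : 0 < Re := lt_of_le_of_ne hRe (Ne.symm h)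
    have : 0 < 1 - ε := by linarith
    exact lt_min (by positivity) (by positivity)

theorem decayRate_le {C Re Wi ε : ℝ} : decayRate C Re Wi ε ≤ 1 / Wi := by
  unfold decayRate
  split_ifs
  · exact le_rfl
  · exact min_le_right _ _

theorem decayRate_mul_le {C Re Wi ε : ℝ} (hC : 0 < C) (hRe : 0 ≤ Re) (hε : ε < 1) :
    decayRate C Re Wi ε * (Re / 2 * C) ≤ 1 - ε := by
  rcases eq_or_ne Re 0 with h | h
  · simp only [h, zero_div, zero_mul, mul_zero]
    linarith
  · have hRe' : 0 < Re := lt_of_le_of_ne hRe (Ne.symm h)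
    rw [decayRate, if_neg h]
    calc min (2 * (1 - ε) / (Re * C)) (1 / Wi) * (Re / 2 * C)
        ≤ 2 * (1 - ε) / (Re * C) * (Re / 2 * C) := by
          gcongr
          exact min_le_left _ _
      _ = 1 - ε := by field_simp

/-- The dissipation controls the free energy. -/
theorem decayRate_mul_freeEnergy_le
    (hD : Bornology.IsBounded (D : Set (EuclideanSpace ℝ (Fin d)))) {C Re Wi ε : ℝ}
    (hC : 0 < C) (hpoincare : ∀ w ∈ H10 D,
      ∫ x : D, w.fn x ^ 2 ≤ C * ∑ j, ∫ x : D, w.grad j x ^ 2)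
    (hRe : 0 ≤ Re) (hWi : 0 < Wi) (hε : 0 < ε) (hε' : ε < 1)
    {u : Fin d → H2 D} {ψ : Fin d → Fin d → C1 D} (hu : ∀ i, (u i).toH1 ∈ H10 D)
    (hψ : ∀ x, (matVal ψ x).transpose = matVal ψ x) :
    decayRate C Re Wi ε * freeEnergy Re Wi ε u ψ ≤ (1 - ε) * gradEnergy u +
      ε / (2 * Wi ^ 2) * ∫ x : D, dissipationDensity ψ x := by
  have := isFiniteMeasure_of_isBounded hD
  have hpos := decayRate_pos hC hRe hWi hε'
  have hP : ∑ i, ∫ x : D, (u i).fn x ^ 2 ≤ C * gradEnergy u := by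
    rw [gradEnergy_eq, Finset.mul_sum]
    exact Finset.sum_le_sum fun i _ => hpoincare _ (hu i)
  have hG : 0 ≤ gradEnergy u := integral_nonneg fun _ =>
    Finset.sum_nonneg fun _ _ => Finset.sum_nonneg fun _ _ => sq_nonneg _
  have hS : ∫ x : D, entropyDensity ψ x ≤ ∫ x : D, dissipationDensity ψ x :=
    integral_mono (integrable_entropyDensity ψ) (integrable_dissipationDensity ψ)
      fun x => entropyDensity_le_dissipationDensity (hψ x)
  have hS0 : 0 ≤ ∫ x : D, entropyDensity ψ x :=
    integral_nonneg fun x => entropyDensity_nonneg (hψ x)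
  rw [freeEnergy, integral_finsetSum _ fun i _ => integrable_sq (u i).fn, mul_add]
  refine add_le_add ?_ ?_
  · calc decayRate C Re Wi ε * (Re / 2 * ∑ i, ∫ x : D, (u i).fn x ^ 2)
        ≤ decayRate C Re Wi ε * (Re / 2 * (C * gradEnergy u)) := by gcongr
      _ = decayRate C Re Wi ε * (Re / 2 * C) * gradEnergy u := by ring
      _ ≤ (1 - ε) * gradEnergy u := by
        gcongr
        exact decayRate_mul_le hC hRe hε'
  · calc decayRate C Re Wi ε * (ε / (2 * Wi) * ∫ x : D, entropyDensity ψ x)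
        ≤ 1 / Wi * (ε / (2 * Wi) * ∫ x : D, dissipationDensity ψ x) := by
          gcongr
          exact decayRate_le
      _ = _ := by field_simp

theorem convex_timeInterval (T : EReal) : Convex ℝ (timeInterval T) := by
  refine Set.OrdConnected.convex ⟨fun a ha b hb c hc => ⟨ha.1.trans hc.1, ?_⟩⟩
  exact (EReal.coe_le_coe_iff.2 hc.2).trans_lt hb.2

/-- A differential inequality `F' ≤ -λ F` on a convex set implies exponential decay. -/
theorem le_mul_exp_of_deriv_le {F F' : ℝ → ℝ} {S : Set ℝ} (hS : Convex ℝ S) {r : ℝ}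
    (hF : ∀ t ∈ S, HasDerivWithinAt F (F' t) S t) (hle : ∀ t ∈ S, F' t ≤ -(r * F t))
    {s t : ℝ} (hs : s ∈ S) (ht : t ∈ S) (hst : s ≤ t) :
    F t ≤ F s * Real.exp (-r * (t - s)) := by
  -- Grönwall by the integrating factor e^{rt}: the product with F is nonincreasing.
  have hG : ∀ t ∈ S, HasDerivWithinAt (fun t => F t * Real.exp (r * t))
      ((F' t + r * F t) * Real.exp (r * t)) S t := fun t ht => by
    have he : HasDerivWithinAt (fun t => Real.exp (r * t)) (Real.exp (r * t) * (r * 1)) S t :=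
      ((hasDerivWithinAt_id t S).const_mul r).exp
    refine ((hF t ht).mul he).congr_deriv ?_
    ring
  have hanti : AntitoneOn (fun t => F t * Real.exp (r * t)) S := by
    refine antitoneOn_of_hasDerivWithinAt_nonpos hS (fun t ht => (hG t ht).continuousWithinAt)
      (fun t ht => (hG t (interior_subset ht)).mono interior_subset) fun t ht => ?_
    exact mul_nonpos_of_nonpos_of_nonneg (by linarith [hle t (interior_subset ht)])
      (Real.exp_pos _).le
  have h := hanti hs ht hst
  calc F t = F t * Real.exp (r * t) * Real.exp (-(r * t)) := by
        rw [mul_assoc, ← Real.exp_add, add_neg_cancel, Real.exp_zero, mul_one]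
    _ ≤ F s * Real.exp (r * s) * Real.exp (-(r * t)) := by gcongr
    _ = F s * Real.exp (-r * (t - s)) := by
        rw [mul_assoc, ← Real.exp_add]
        congr 2
        ring

end LogOldroydB

end FreeEnergy

theorem mainTheorem12 (d : ℕ) (hd : d = 2 ∨ d = 3)
    (D : TopologicalSpace.Opens (EuclideanSpace ℝ (Fin d)))
    (hD : Bornology.IsBounded (D : Set (EuclideanSpace ℝ (Fin d)))) :
    ∃ C : ℝ, 0 < C ∧
      ∀ (Re Wi ε : ℝ) (T : EReal), 0 ≤ Re → 0 < Wi → 0 < ε → ε < 1 → 0 < T →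
      ∀ (u : ℝ → Fin d → LogOldroydB.H2 D) (p : ℝ → LogOldroydB.H1 D)
        (ψ : ℝ → Fin d → Fin d → LogOldroydB.C1 D),
        LogOldroydB.IsSmoothSolution D Re Wi ε T u p ψ →
        -- all integrals in the free energy and in the identity converge absolutely
        (∀ t ∈ LogOldroydB.timeInterval T,
          MeasureTheory.Integrable (fun x : D => ∑ i, (u t i).fn x ^ 2) ∧
          MeasureTheory.Integrable (fun x : D => ∑ i, ∑ j, (u t i).grad j x ^ 2) ∧
          MeasureTheory.Integrable (fun x : D => LogOldroydB.entropyDensity (ψ t) x) ∧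
          MeasureTheory.Integrable (fun x : D => LogOldroydB.dissipationDensity (ψ t) x)) ∧
        -- the free energy identity
        (∀ t ∈ LogOldroydB.timeInterval T, ∃ F' : ℝ,
          HasDerivWithinAt (fun s => LogOldroydB.freeEnergy Re Wi ε (u s) (ψ s)) F'
            (LogOldroydB.timeInterval T) t ∧
          F' + (1 - ε) * LogOldroydB.gradEnergy (u t) +
            ε / (2 * Wi ^ 2) * ∫ x : D, LogOldroydB.dissipationDensity (ψ t) x = 0) ∧
        -- exponential decay to zero
        0 < LogOldroydB.decayRate C Re Wi ε ∧
        (∀ t ∈ LogOldroydB.timeInterval T, 0 ≤ LogOldroydB.freeEnergy Re Wi ε (u t) (ψ t)) ∧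
        (∀ s ∈ LogOldroydB.timeInterval T, ∀ t ∈ LogOldroydB.timeInterval T, s ≤ t →
          LogOldroydB.freeEnergy Re Wi ε (u t) (ψ t) ≤
            LogOldroydB.freeEnergy Re Wi ε (u s) (ψ s) *
              Real.exp (-LogOldroydB.decayRate C Re Wi ε * (t - s))) ∧
        (T = ⊤ → Filter.Tendsto (fun t => LogOldroydB.freeEnergy Re Wi ε (u t) (ψ t))
          Filter.atTop (nhds 0)) := by
  -- C is the Poincaré constant, fixed before Re, Wi, ε and T, so it depends only on D.
  obtain ⟨C, hC, hP⟩ := LogOldroydB.H10.exists_poincare hd hD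
  refine ⟨C, hC, fun Re Wi ε T hRe hWi hε hε' hT u p ψ hsol => ?_⟩
  have := LogOldroydB.isFiniteMeasure_of_isBounded hD
  have hF := fun t ht => hsol.hasDerivWithinAt_freeEnergy hd hD hWi (t := t) ht
  have hpos := LogOldroydB.decayRate_pos hC hRe hWi hε'
  have hnn : ∀ t ∈ LogOldroydB.timeInterval T,
      0 ≤ LogOldroydB.freeEnergy Re Wi ε (u t) (ψ t) := fun t ht =>
    LogOldroydB.freeEnergy_nonneg hRe hWi hε (hsol.symm_ψ t ht)
  have hdecay : ∀ s ∈ LogOldroydB.timeInterval T, ∀ t ∈ LogOldroydB.timeInterval T, s ≤ t →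
      LogOldroydB.freeEnergy Re Wi ε (u t) (ψ t) ≤
        LogOldroydB.freeEnergy Re Wi ε (u s) (ψ s) *
          Real.exp (-LogOldroydB.decayRate C Re Wi ε * (t - s)) := fun s hs t ht hst =>
    LogOldroydB.le_mul_exp_of_deriv_le
      (F := fun t => LogOldroydB.freeEnergy Re Wi ε (u t) (ψ t))
      (LogOldroydB.convex_timeInterval T) hF (fun r hr => by
        have := LogOldroydB.decayRate_mul_freeEnergy_le hD hC hP hRe hWi hε hε'
          (hsol.dirichlet r hr) (hsol.symm_ψ r hr)
        linarith) hs ht hst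
  refine ⟨fun t ht => ⟨?_, ?_, LogOldroydB.integrable_entropyDensity _,
    LogOldroydB.integrable_dissipationDensity _⟩, fun t ht => ⟨_, hF t ht, by ring⟩, hpos, hnn,
    hdecay, ?_⟩
  · exact integrable_finsetSum _ fun i _ => LogOldroydB.integrable_sq _
  · exact integrable_finsetSum _ fun i _ => integrable_finsetSum _ fun j _ =>
      LogOldroydB.integrable_sq _
  · rintro rfl
    have hmem : ∀ t : ℝ, 0 ≤ t → t ∈ LogOldroydB.timeInterval ⊤ := fun t ht =>
      ⟨ht, EReal.coe_lt_top t⟩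
    have hexp : Filter.Tendsto (fun t : ℝ => LogOldroydB.freeEnergy Re Wi ε (u 0) (ψ 0) *
        Real.exp (-LogOldroydB.decayRate C Re Wi ε * (t - 0))) Filter.atTop (nhds 0) := by
      have h1 : Filter.Tendsto (fun t : ℝ => -LogOldroydB.decayRate C Re Wi ε * (t - 0))
          Filter.atTop Filter.atBot := by
        simp only [sub_zero]
        exact Filter.tendsto_id.const_mul_atTop_of_neg (neg_lt_zero.2 hpos)
      simpa using (Real.tendsto_exp_atBot.comp h1).const_mul
        (LogOldroydB.freeEnergy Re Wi ε (u 0) (ψ 0))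
    refine tendsto_of_tendsto_of_tendsto_of_le_of_le' tendsto_const_nhds hexp ?_ ?_
    · filter_upwards [Filter.eventually_ge_atTop 0] with t ht
      exact hnn t (hmem t ht)
    · filter_upwards [Filter.eventually_ge_atTop 0] with t ht
      exact hdecay 0 (hmem 0 le_rfl) t (hmem t ht) ht
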